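/- **Random matrix model.** Let $Q(i,j)$, $\widetilde Q(i,j)$ ($i\ne j$ in $\mathbb N$) and $\Psi_i$ ($i\in\mathbb N$) be real random variables on a probability space $(\Omega',\mathbb P)$ such that $Q(i,j)=Q(j,i)$; all the variables $Q(i,j)$ ($i<j$), $\widetilde Q(i,j)$ ($i\neq j$), $\Psi_i$ are independent; the $Q(i,j)$ are identically distributed, and so are the $\widetilde Q(i,j)$; the laws of $Q(i,j)$ and of $\widetilde Q(i,j)$ have compact support separated from $0$; the $\Psi_i$ take values almost surely in a common compact set; and $\sum_i \mathrm{Var}(\Psi_i)<\infty$. For $x\in\mathbb R$ put $\sigma_x=\begin{pmatrix}1&0\\0&x\end{pmatrix}$, $\gamma_x=\begin{pmatrix}0&0\\x&0\end{pmatrix}$, and in $\mathcal A_N=M_2(\mathbb R)^{\otimes N}$ (with the transpose as $*$) put, for $1\le i\le N$, $$T_{N,i}=\sigma_{Q(1,i)}\otimes\dots\otimes\sigma_{Q(i-1,i)}\otimes\gamma_1\otimes\sigma_1\otimes\dots\otimes\sigma_1,$$ $$T'_{N,i}=\sigma_{\widetilde Q(1,i)}\otimes\dots\otimes\sigma_{\widetilde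 Q(i-1,i)}\otimes\gamma_{\Psi_i}\otimes\sigma_{Q(i+1,i)\widetilde Q(i+1,i)}\otimes\dots\otimes\sigma_{Q(N,i)\widetilde Q(N,i)}.$$ Let $S_N=N^{-1/2}\sum_{i=1}^N T_{N,i}$, $S'_N=N^{-1/2}\sum_{i=1}^N T'_{N,i}$, $Z_N=S_N+S_N^*+S'_N$, and let $\varphi_N$ be the linear functional $\varphi_N(a_1\otimes\dots\otimes a_N)=\prod_k (a_k)_{11}$. **Gaussian operator of type B.** Let $H$ be a complex Hilbert space (inner product antilinear on the left) with a bounded self-adjoint linear involution $x\mapsto\bar x$, and let $\alpha,q\in(-1,1)$. On the algebraic full Fock space $\bigoplus_{n\ge0}H^{\otimes n}$ with vacuum $\Omega$ let $b^*_{\alpha,q}(x)$ be the creation operator $\eta\mapsto\eta\otimes x$, and let $b_{\alpha,q}(x)$ be the operator determined by $b_{\alpha,q}(x)\Omega=0$ and $$b_{\alpha,q}(x)b^*_{\alpha,q}(y)-q\,b^*_{\alpha,q}(y)b_{\alpha,q}(x)=\langle x,y\rangle I+\alpha\langle x,\bar y\rangle q^{2N}\qquad(x,y\in H),$$ where $q^{2N}$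 acts on $H^{\otimes n}$ as $q^{2n}$. Let $\langle\cdot,\cdot\rangle_{\alpha,q}$ be the sesquilinear form for which $\Omega$ is a unit vector orthogonal to $H^{\otimes n}$, $n\ge1$, and $b^*_{\alpha,q}(x)$ is the adjoint of $b_{\alpha,q}(x)$, and put $G_{\alpha,q}(x)=b_{\alpha,q}(x)+b^*_{\alpha,q}(x)$. **Partitions.** Let $\mathcal P_2^B(2n)$ be the set of pairs $\pi_f=(\pi,f)$, where $\pi$ is a partition of $\{1,\dots,2n\}$ into blocks of size two and $f:\pi\to\{1,-1\}$. Write $\mathrm{NB}(\pi_f)$ for the number of blocks with $f=-1$; $\mathrm{Cr}(\pi)$ for the number of unordered pairs $\{V,W\}\subset\pi$ that cross, i.e. such that (in one of the two orders) $i<k<j<l$ for some $i,j\in V$, $k,l\in W$; and $\mathrm{Nest}(\pi_f)$ for the number of $(V,W)\in\pi\times\pi$ such that $f(W)=-1$ and there are $i,j\in V$ with $i<k<j$ for all $k\in W$. **Corollary.** Let $e\in H$ be a unit vector and assume, for all $i\ne j$, $\mathbb E\,Q(i,j)=q$, $\mathbb E\,Q(i,j)^2=1$, $\mathbb E\,\widetilde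 Q(i,j)=q$, and, for all $i$, $\mathbb E\,\Psi_i=\alpha\langle e,\bar e\rangle$. Then, almost surely, for all $n\ge0$, $$\lim_{N\to\infty}\varphi_N(Z_N^{2n})=\sum_{\pi_f\in\mathcal P^B_2(2n)}\alpha^{\mathrm{NB}(\pi_f)}q^{\mathrm{Cr}(\pi)+2\,\mathrm{Nest}(\pi_f)}\langle e,\bar e\rangle^{\mathrm{NB}(\pi_f)}=\langle\Omega,G_{\alpha,q}(e)^{2n}\Omega\rangle_{\alpha,q}.$$ Moreover the model is an asymptotic model for $G_{\alpha,q}(e)$: almost surely, for every $k\ge0$, $\lim_{N\to\infty}\varphi_N(Z_N^{k})=\langle\Omega,G_{\alpha,q}(e)^{k}\Omega\rangle_{\alpha,q}$. -/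

import Mathlib

open scoped TensorProduct

namespace TypeB

/-! ## Pair partitions of type B and their statistics -/

noncomputable section Partitions

/-- Pair partitions of an `m`-element linearly ordered set. -/
abbrev PairPartition (m : ℕ) : Type :=
  {π : Finpartition (Finset.univ : Finset (Fin m)) // ∀ V ∈ π.parts, V.card = 2}

/-- Pair partitions of type B: a pair partition `π` with a colouring `f : π → {1, -1}` of its
blocks. -/
abbrev PairPartitionB (m : ℕ) : Type :=
  Σ π : PairPartition m, (π.1.parts → ℤˣ)

/-- `V` crosses `W`: there are `i, j ∈ V` and `k, l ∈ W` with `i < k < j < l`. -/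
def Crosses {m : ℕ} (V W : Finset (Fin m)) : Prop :=
  ∃ i ∈ V, ∃ j ∈ V, ∃ k ∈ W, ∃ l ∈ W, i < k ∧ k < j ∧ j < l

/-- `V` nests `W`: there are `i, j ∈ V` with `i < k < j` for every `k ∈ W`. -/
def Nests {m : ℕ} (V W : Finset (Fin m)) : Prop :=
  ∃ i ∈ V, ∃ j ∈ V, ∀ k ∈ W, i < k ∧ k < j

/-- The number of blocks of colour `-1`. -/
def NB {m : ℕ} (π : PairPartitionB m) : ℕ :=
  Nat.card {V : π.1.1.parts // π.2 V = -1}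

/-- The number of crossings. In a crossing pair of two-element blocks exactly one of the two blocks
opens first, so each unordered crossing pair `{V, W}` is counted once below. -/
def Cr {m : ℕ} (π : PairPartition m) : ℕ :=
  Nat.card {p : π.1.parts × π.1.parts // Crosses (p.1 : Finset (Fin m)) (p.2 : Finset (Fin m))}

/-- The number of pairs `(V, W)` of blocks such that `W` has colour `-1` and `V` nests `W`. -/
def Nest {m : ℕ} (π : PairPartitionB m) : ℕ :=
  Nat.card {p : π.1.1.parts × π.1.1.parts //
    π.2 p.2 = -1 ∧ Nests (p.1 : Finset (Fin m)) (p.2 : Finset (Fin m))}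

end Partitions

/-! ## The `(α, q)`-Gaussian operator of type B on the algebraic full Fock space -/

noncomputable section Fock

/-- The algebraic full Fock space `⨁ₙ H^{⊗ n}`. Elementary tensors `x₁ ⊗ ⋯ ⊗ xₙ` are products
`ι x₁ * ⋯ * ι xₙ`. -/
abbrev Fock (H : Type*) [NormedAddCommGroup H] [InnerProductSpace ℂ H] : Type _ :=
  TensorAlgebra ℂ H

variable {H : Type*} [NormedAddCommGroup H] [InnerProductSpace ℂ H]

/-- The vacuum vector `Ω`. -/
def vacuum : Fock H := 1

/-- The operator `q^{2N}`: multiplication by `q^{2n}` on `H^{⊗ n}`. -/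
def qPow2N (q : ℝ) : Fock H →ₗ[ℂ] Fock H :=
  (TensorAlgebra.lift ℂ (((q : ℂ) ^ 2) • TensorAlgebra.ι ℂ (M := H))).toLinearMap

/-- The (right) creation operator `x₁ ⊗ ⋯ ⊗ xₙ ↦ x₁ ⊗ ⋯ ⊗ xₙ ⊗ x`. -/
def creation (x : H) : Module.End ℂ (Fock H) :=
  LinearMap.mulRight ℂ (TensorAlgebra.ι ℂ x)

/-- One step of the recursion that computes `(η, b(x) η)`: appending the letter `y` to `η` sends it
to `(η ⊗ y, q b(x)η ⊗ y + ⟨x, y⟩ η + α ⟨x, Jy⟩ q^{2N} η)`. -/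
def annihilationStep (α q : ℝ) (J : H →L[ℂ] H) (x : H) :
    H →ₗ[ℂ] (Module.End ℂ (Fock H × Fock H))ᵐᵒᵖ :=
  (MulOpposite.opLinearEquiv ℂ).toLinearMap ∘ₗ
    LinearMap.mk₂ ℂ
      (fun (y : H) (p : Fock H × Fock H) =>
        ((creation y p.1,
          (q : ℂ) • creation y p.2 + inner ℂ x y • p.1
            + ((α : ℂ) * inner ℂ x (J y)) • qPow2N q p.1) : Fock H × Fock H))
      (by
        intro y z p
        ext <;> simp only [creation, map_add, LinearMap.mulRight_apply, mul_add, inner_add_right,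
          add_smul, smul_add, Prod.fst_add, Prod.snd_add]
        abel)
      (by
        intro c y p
        ext <;> simp only [creation, map_smul, LinearMap.mulRight_apply, mul_smul_comm,
          inner_smul_right, smul_add, smul_smul, Prod.smul_fst, Prod.smul_snd, mul_comm,
          mul_left_comm])
      (by
        intro y p r
        ext <;> simp only [map_add, smul_add, Prod.fst_add, Prod.snd_add]
        abel)
      (by
        intro c y p
        ext <;> simp only [map_smul, smul_add, smul_smul, Prod.smul_fst, Prod.smul_snd, mul_comm])

/-- The annihilation operator `b_{α,q}(x)`: the unique operator with `b(x) Ω = 0` and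
`b(x) b*(y) - q b*(y) b(x) = ⟨x, y⟩ I + α ⟨x, Jy⟩ q^{2N}` for all `y`
(see `annihilation_vacuum` and `annihilation_creation`). -/
def annihilation (α q : ℝ) (J : H →L[ℂ] H) (x : H) : Module.End ℂ (Fock H) where
  toFun η := (MulOpposite.unop (TensorAlgebra.lift ℂ (annihilationStep α q J x) η) (1, 0)).2
  map_add' η ζ := by simp
  map_smul' c η := by simp

/-- A linear subspace of the Fock space that contains `Ω` and is stable under all creation
operators is everything. -/
theorem mem_of_creation (p : Submodule ℂ (Fock H)) (h1 : (vacuum : Fock H) ∈ p)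
    (hc : ∀ η ∈ p, ∀ y : H, creation y η ∈ p) (η : Fock H) : η ∈ p := by
  suffices h : ∀ a : Fock H, ∀ ζ ∈ p, ζ * a ∈ p by simpa [vacuum] using h η _ h1
  intro a
  induction a using TensorAlgebra.induction with
  | algebraMap r =>
    intro ζ hζ
    rw [← Algebra.commutes, ← Algebra.smul_def]
    exact p.smul_mem r hζ
  | ι x => exact fun ζ hζ => hc ζ hζ x
  | mul a b ha hb =>
    intro ζ hζ
    rw [← mul_assoc]
    exact hb _ (ha _ hζ)
  | add a b ha hb =>
    intro ζ hζ
    rw [mul_add]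
    exact p.add_mem (ha _ hζ) (hb _ hζ)

theorem annihilation_vacuum (α q : ℝ) (J : H →L[ℂ] H) (x : H) :
    annihilation α q J x vacuum = 0 := by
  simp [annihilation, vacuum]

theorem annihilationStep_lift (α q : ℝ) (J : H →L[ℂ] H) (x y : H) (η : Fock H)
    (p : Fock H × Fock H) :
    MulOpposite.unop (TensorAlgebra.lift ℂ (annihilationStep α q J x) (creation y η)) p =
      (creation y (MulOpposite.unop (TensorAlgebra.lift ℂ (annihilationStep α q J x) η) p).1,
        (q : ℂ) • creation y
            (MulOpposite.unop (TensorAlgebra.lift ℂ (annihilationStep α q J x) η) p).2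
          + inner ℂ x y • (MulOpposite.unop (TensorAlgebra.lift ℂ (annihilationStep α q J x) η) p).1
          + ((α : ℂ) * inner ℂ x (J y)) • qPow2N q
            (MulOpposite.unop (TensorAlgebra.lift ℂ (annihilationStep α q J x) η) p).1) := by
  rw [creation, LinearMap.mulRight_apply, map_mul, TensorAlgebra.lift_ι_apply]
  rfl

theorem annihilation_fst (α q : ℝ) (J : H →L[ℂ] H) (x : H) (η : Fock H) :
    (MulOpposite.unop (TensorAlgebra.lift ℂ (annihilationStep α q J x) η) (1, 0)).1 = η := by
  let L : Fock H →ₗ[ℂ] Fock H :=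
    { toFun := fun η =>
        (MulOpposite.unop (TensorAlgebra.lift ℂ (annihilationStep α q J x) η) (1, 0)).1
      map_add' := fun η ζ => by simp
      map_smul' := fun c η => by simp }
  refine mem_of_creation (LinearMap.eqLocus L LinearMap.id) ?_ ?_ η
  · simp [L, vacuum]
  · intro ζ hζ y
    have h : (MulOpposite.unop
        (TensorAlgebra.lift ℂ (annihilationStep α q J x) ζ) (1, 0)).1 = ζ := hζ
    change (MulOpposite.unop
      (TensorAlgebra.lift ℂ (annihilationStep α q J x) (creation y ζ)) (1, 0)).1 = creation y ζ
    rw [annihilationStep_lift, h]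

/-- The commutation relation
`b(x) b*(y) - q b*(y) b(x) = ⟨x, y⟩ I + α ⟨x, Jy⟩ q^{2N}`. -/
theorem annihilation_creation (α q : ℝ) (J : H →L[ℂ] H) (x y : H) :
    annihilation α q J x * creation y - (q : ℂ) • (creation y * annihilation α q J x)
      = inner ℂ x y • (1 : Module.End ℂ (Fock H))
        + ((α : ℂ) * inner ℂ x (J y)) • qPow2N q := by
  rw [sub_eq_iff_eq_add]
  refine LinearMap.ext fun η => ?_
  have h := annihilation_fst α q J x η
  have h2 : annihilation α q J x (creation y η) =
      (q : ℂ) • creation y (annihilation α q J x η) + inner ℂ x y • η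
        + ((α : ℂ) * inner ℂ x (J y)) • qPow2N q η := by
    change (MulOpposite.unop
      (TensorAlgebra.lift ℂ (annihilationStep α q J x) (creation y η)) (1, 0)).2 = _
    rw [annihilationStep_lift, h]
    rfl
  simp only [Module.End.mul_apply, h2, LinearMap.add_apply, LinearMap.smul_apply,
    Module.End.one_apply]
  abel

theorem annihilation_creation_apply (α q : ℝ) (J : H →L[ℂ] H) (x y : H) (η : Fock H) :
    annihilation α q J x (creation y η) = (q : ℂ) • creation y (annihilation α q J x η)
      + (inner ℂ x y • η + ((α : ℂ) * inner ℂ x (J y)) • qPow2N q η) := by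
  have h := LinearMap.congr_fun (annihilation_creation α q J x y) η
  simp only [Module.End.mul_apply, LinearMap.add_apply, LinearMap.sub_apply, LinearMap.smul_apply,
    Module.End.one_apply] at h
  rw [← h]
  abel

theorem annihilation_add (α q : ℝ) (J : H →L[ℂ] H) (x z : H) :
    annihilation α q J (x + z) = annihilation α q J x + annihilation α q J z := by
  refine LinearMap.ext fun η => ?_
  refine mem_of_creation (LinearMap.eqLocus (annihilation α q J (x + z))
    (annihilation α q J x + annihilation α q J z)) ?_ ?_ η
  · simp [LinearMap.mem_eqLocus, annihilation_vacuum]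
  · intro ζ hζ y
    rw [LinearMap.mem_eqLocus, LinearMap.add_apply] at hζ ⊢
    simp only [annihilation_creation_apply, hζ, inner_add_left, map_add, mul_add, add_smul,
      smul_add]
    abel

theorem annihilation_smul (α q : ℝ) (J : H →L[ℂ] H) (c : ℂ) (x : H) :
    annihilation α q J (c • x) = (starRingEnd ℂ c) • annihilation α q J x := by
  refine LinearMap.ext fun η => ?_
  refine mem_of_creation (LinearMap.eqLocus (annihilation α q J (c • x))
    ((starRingEnd ℂ c) • annihilation α q J x)) ?_ ?_ η
  · simp [LinearMap.mem_eqLocus, annihilation_vacuum]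
  · intro ζ hζ y
    rw [LinearMap.mem_eqLocus, LinearMap.smul_apply] at hζ ⊢
    simp only [annihilation_creation_apply, hζ, inner_smul_left, map_smul, smul_add, smul_smul,
      mul_comm (starRingEnd ℂ c), mul_assoc]

/-- The vacuum coefficient of a vector of the Fock space. -/
def vacuumCoeff : Fock H →ₗ[ℂ] ℂ := TensorAlgebra.algebraMapInv.toLinearMap

/-- For `y : H`, the operation `T ↦ T ∘ b_{α,q}(y)` on antilinear functionals of the Fock space
(linear in `y`, since `b_{α,q}` is antilinear in `y`). -/
def precompAnnihilation (α q : ℝ) (J : H →L[ℂ] H) :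
    H →ₗ[ℂ] (Module.End ℂ (Fock H →ₗ⋆[ℂ] ℂ))ᵐᵒᵖ :=
  (MulOpposite.opLinearEquiv ℂ).toLinearMap ∘ₗ
    LinearMap.mk₂ ℂ
      (fun (y : H) (T : Fock H →ₗ⋆[ℂ] ℂ) => T.comp (annihilation α q J y))
      (by intro y z T; ext ξ; simp [annihilation_add])
      (by intro c y T; ext ξ; simp [annihilation_smul])
      (by intro y T S; ext ξ; simp)
      (by intro c y T; ext ξ; simp)

/-- The deformed inner product `⟨ξ, η⟩_{α,q}`, antilinear in `ξ` and linear in `η`: the unique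
sesquilinear form for which `Ω` is a unit vector orthogonal to `H^{⊗ n}`, `n ≥ 1`, and `b*(y)` is the
adjoint of `b(y)` (see `deformedInner_vacuum` and `deformedInner_creation`). -/
def deformedInner (α q : ℝ) (J : H →L[ℂ] H) (ξ η : Fock H) : ℂ :=
  MulOpposite.unop (TensorAlgebra.lift ℂ (precompAnnihilation α q J) η)
    ((starLinearEquiv ℂ (A := ℂ)).toLinearMap.comp vacuumCoeff) ξ

theorem deformedInner_vacuum (α q : ℝ) (J : H →L[ℂ] H) (ξ : Fock H) :
    deformedInner α q J ξ vacuum = star (vacuumCoeff ξ) := by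
  simp [deformedInner, vacuum]

/-- `b*(y)` is the adjoint of `b(y)` for the deformed inner product. -/
theorem deformedInner_creation (α q : ℝ) (J : H →L[ℂ] H) (y : H) (ξ η : Fock H) :
    deformedInner α q J (annihilation α q J y ξ) η = deformedInner α q J ξ (creation y η) := by
  simp [deformedInner, creation, precompAnnihilation]

/-- The Gaussian operator of type B, `G_{α,q}(x) = b_{α,q}(x) + b*_{α,q}(x)`. -/
def gaussian (α q : ℝ) (J : H →L[ℂ] H) (x : H) : Module.End ℂ (Fock H) :=
  annihilation α q J x + creation x

/-- The vacuum moment `⟨Ω, G_{α,q}(x)^k Ω⟩_{α,q}`. -/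
def vacuumMoment (α q : ℝ) (J : H →L[ℂ] H) (x : H) (k : ℕ) : ℂ :=
  deformedInner α q J vacuum ((gaussian α q J x ^ k) vacuum)

end Fock

/-! ## The matrix model -/

noncomputable section Model

/-- `σ_x = diag(1, x)`. -/
def sigma (x : ℝ) : Matrix (Fin 2) (Fin 2) ℝ := !![1, 0; 0, x]

/-- `γ_x`, with the single entry `x` in the lower left corner. -/
def gamma (x : ℝ) : Matrix (Fin 2) (Fin 2) ℝ := !![0, 0; x, 0]

/-- The algebra `M₂(ℝ)^{⊗ N}`. -/
abbrev Alg (N : ℕ) : Type := ⨂[ℝ] _ : Fin N, Matrix (Fin 2) (Fin 2) ℝ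

/-- The involution of `M₂(ℝ)^{⊗ N}`: the (conjugate) transpose in every tensor factor. -/
def adj (N : ℕ) : Alg N →ₗ[ℝ] Alg N :=
  PiTensorProduct.map fun _ =>
    (Matrix.transposeLinearEquiv (Fin 2) (Fin 2) ℝ ℝ).toLinearMap

/-- The linear functional `a₁ ⊗ ⋯ ⊗ a_N ↦ ∏ₖ ⟨e₁ aₖ, e₁⟩`, where `⟨e₁ a, e₁⟩` is the upper left
entry of `a`. -/
def phi (N : ℕ) : Alg N →ₗ[ℝ] ℝ :=
  PiTensorProduct.lift
    ((MultilinearMap.mkPiAlgebra ℝ (Fin N) ℝ).compLinearMap fun _ => Matrix.entryLinearMap ℝ ℝ 0 0)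

/-- `T_{N,i} = σ_{Q(1,i)} ⊗ ⋯ ⊗ σ_{Q(i-1,i)} ⊗ γ_1 ⊗ σ_1 ⊗ ⋯ ⊗ σ_1`. -/
def T (N : ℕ) (Q : ℕ → ℕ → ℝ) (i : Fin N) : Alg N :=
  PiTensorProduct.tprod ℝ fun k : Fin N =>
    if k < i then sigma (Q k i) else if k = i then gamma 1 else sigma 1

/-- `T'_{N,i} = σ_{Q̃(1,i)} ⊗ ⋯ ⊗ σ_{Q̃(i-1,i)} ⊗ γ_{Ψ_i} ⊗ σ_{Q(i+1,i) Q̃(i+1,i)} ⊗ ⋯ ⊗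
σ_{Q(N,i) Q̃(N,i)}`; here `R` stands for `Q̃`. -/
def T' (N : ℕ) (Q R : ℕ → ℕ → ℝ) (Ψ : ℕ → ℝ) (i : Fin N) : Alg N :=
  PiTensorProduct.tprod ℝ fun k : Fin N =>
    if k < i then sigma (R k i) else if k = i then gamma (Ψ i) else sigma (Q k i * R k i)

/-- `S_N = (T_{N,1} + ⋯ + T_{N,N}) / √N`. -/
def S (N : ℕ) (Q : ℕ → ℕ → ℝ) : Alg N :=
  (Real.sqrt N)⁻¹ • ∑ i : Fin N, T N Q i

/-- `S'_N = (T'_{N,1} + ⋯ + T'_{N,N}) / √N`. -/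
def S' (N : ℕ) (Q R : ℕ → ℕ → ℝ) (Ψ : ℕ → ℝ) : Alg N :=
  (Real.sqrt N)⁻¹ • ∑ i : Fin N, T' N Q R Ψ i

/-- `Z_N = S_N + S_N^* + S'_N`. -/
def Z (N : ℕ) (Q R : ℕ → ℕ → ℝ) (Ψ : ℕ → ℝ) : Alg N :=
  S N Q + adj N (S N Q) + S' N Q R Ψ

open MeasureTheory ProbabilityTheory in
/-- The standing assumptions on the random entries `Q(i,j)`, `R(i,j) = Q̃(i,j)` (`i ≠ j`) and `Ψ_i`
of the matrix model. -/
structure EntryModel {Ω : Type*} [MeasurableSpace Ω] (P : Measure Ω)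
    (Q R : ℕ → ℕ → Ω → ℝ) (Ψ : ℕ → Ω → ℝ) : Prop where
  measurable_Q : ∀ i j, i ≠ j → Measurable (Q i j)
  measurable_R : ∀ i j, i ≠ j → Measurable (R i j)
  measurable_Ψ : ∀ i, Measurable (Ψ i)
  /-- `Q(i,j) = Q(j,i)` -/
  symm_Q : ∀ i j, j < i → Q i j = Q j i
  /-- The variables `Q(i,j)` (`i < j`), `R(i,j)` (`i ≠ j`), `Ψ_i` are all independent. -/
  indep : iIndepFun
    (Sum.elim (fun p : {p : ℕ × ℕ // p.1 < p.2} => Q p.1.1 p.1.2)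
      (Sum.elim (fun p : {p : ℕ × ℕ // p.1 ≠ p.2} => R p.1.1 p.1.2) Ψ)) P
  ident_Q : ∀ i j k l, i < j → k < l → IdentDistrib (Q i j) (Q k l) P P
  ident_R : ∀ i j k l, i ≠ j → k ≠ l → IdentDistrib (R i j) (R k l) P P
  /-- `Q(i,j)` has compact support separated from zero. -/
  support_Q : ∃ D : Set ℝ, IsCompact D ∧ (∃ ε > 0, ∀ x ∈ D, ε ≤ |x|) ∧
    ∀ i j, i ≠ j → ∀ᵐ ω ∂P, Q i j ω ∈ D
  /-- `R(i,j)` has compact support separated from zero. -/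
  support_R : ∃ D : Set ℝ, IsCompact D ∧ (∃ ε > 0, ∀ x ∈ D, ε ≤ |x|) ∧
    ∀ i j, i ≠ j → ∀ᵐ ω ∂P, R i j ω ∈ D
  /-- The `Ψ_i` have supports in a common compact set. -/
  support_Ψ : ∃ D : Set ℝ, IsCompact D ∧ ∀ i, ∀ᵐ ω ∂P, Ψ i ω ∈ D
  /-- The variances of the `Ψ_i` are summable. -/
  summable_variance : Summable fun i => variance (Ψ i) P

end Model

end TypeB

/-! Both sides equal one sum over pair partitions of type B; for odd `k` that sum is empty.

Fock side: since `e` is a unit vector, `G` preserves the span of the vectors `e ⊗ ⋯ ⊗ e` and acts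
there as a Jacobi operator with coefficients `[p]_q (1 + t q^(p-1))`, where `t = α⟨e, ē⟩`. Each
coefficient splits as a sum over `p` open points, so a moment becomes a sum over matchings
(`vacuumMoment_eq_sum_matchings`). An arc that crosses `r` arcs opened after it and lies under `s`
arcs contributes `q^r (1 + t q^(2s))`, and the two summands are the two colours
(`sum_colour_weight`).

Matrix side: `φ_N(Z_N^k)` is `N^(-k/2)` times a sum over words, and each word weight factors over
the sites (`phi_Z_pow`). A letter is off-diagonal only at its own site, so every visited site must
be visited an even number of times. Words with fewer than `k/2` sites are too few to matter
(`tendsto_sum_words_sub`). The other nonzero words come from a coloured pair partition and an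
injective choice `g` of sites (`exists_pairWord_eq`): a block opens with `T*` and closes with `T`
(colour `1`) or `T'` (colour `-1`).

The weight of such a word is a product of the `Ψ` at the blocks of colour `-1` and of an
`interaction` in the entries. By independence and `E Q² = 1` the latter has mean `q^(Cr + 2 Nest)`
for every `g` (`prod_means_eq`). Interactions of `g` and `g'` are uncorrelated unless `g` and `g'`
share two sites, so the average over `g` has variance `O(N⁻²)`, which is summable: the averages
converge almost surely (`EntryModel.ae_tendsto_interaction`). Summable variances also give `Ψ_i → t`
almost surely, and a Cesàro argument replaces each `Ψ` by `t` (`tendsto_sum_pairWord`). -/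

namespace TypeB

open Finset

/-! ### The Jacobi recursion of the type B Gaussian operator -/

section Jacobi

/-- The coefficients `[p]_q (1 + t q^{p-1})`, defined by their recursion. -/
noncomputable def jacobiCoeff (q t : ℂ) : ℕ → ℂ
  | 0 => 0
  | p + 1 => q * jacobiCoeff q t p + (1 + t * q ^ (2 * p))

/-- A new largest point gives every old summand one more factor `q` and itself contributes `1 + t
q^(2p)`. This spreads the annihilation coefficient over the points that can be closed. -/
theorem sum_rank_eq_jacobiCoeff {ι : Type*} [LinearOrder ι] (q t : ℂ) (O : Finset ι) :
    ∑ j ∈ O, q ^ #{b ∈ O | j < b} * (1 + t * q ^ (2 * #{b ∈ O | b < j}))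
      = jacobiCoeff q t #O := by
  induction O using Finset.induction_on_max with
  | empty => simp [jacobiCoeff]
  | insert a s ha ih =>
    have has : a ∉ s := fun h => lt_irrefl _ (ha a h)
    rw [sum_insert has, card_insert_of_notMem has, jacobiCoeff, ← ih, mul_sum, add_comm]
    congr 1
    · refine sum_congr rfl fun j hj => ?_
      have h1 : {b ∈ insert a s | j < b} = insert a {b ∈ s | j < b} := by
        rw [filter_insert, if_pos (ha j hj)]
      have h2 : {b ∈ insert a s | b < j} = {b ∈ s | b < j} := by
        rw [filter_insert, if_neg (ha j hj).not_gt]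
      rw [h1, h2, card_insert_of_notMem (by simp [has]), pow_succ]
      ring
    · have h1 : {b ∈ insert a s | a < b} = ∅ := by
        rw [filter_eq_empty_iff]
        intro b hb
        rcases mem_insert.1 hb with rfl | hb
        · exact lt_irrefl _
        · exact (ha b hb).not_gt
      have h2 : {b ∈ insert a s | b < a} = s := by
        rw [filter_insert, if_neg (lt_irrefl a), filter_true_of_mem ha]
      rw [h1, h2]
      simp

end Jacobi

section FockMoment

variable {H : Type*} [NormedAddCommGroup H] [InnerProductSpace ℂ H]

/-- The vector `e ⊗ ⋯ ⊗ e` (`p` factors). -/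
noncomputable def powerVec (e : H) (p : ℕ) : Fock H := (creation e ^ p) vacuum

theorem creation_powerVec (e : H) (p : ℕ) : creation e (powerVec e p) = powerVec e (p + 1) := by
  rw [powerVec, powerVec, pow_succ', Module.End.mul_apply]

theorem qPow2N_powerVec (q : ℝ) (e : H) (p : ℕ) :
    qPow2N q (powerVec e p) = ((q : ℂ) ^ (2 * p)) • powerVec e p := by
  induction p with
  | zero => simp [powerVec, vacuum, qPow2N]
  | succ p ih =>
    rw [← creation_powerVec]
    simp only [creation, LinearMap.mulRight_apply]
    have : qPow2N q (powerVec e p * TensorAlgebra.ι ℂ e)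
        = qPow2N q (powerVec e p) * (((q : ℂ) ^ 2) • TensorAlgebra.ι ℂ e) := by
      simp [qPow2N]
    rw [this, ih]
    simp only [smul_mul_assoc, mul_smul_comm, smul_smul]
    congr 1
    ring

theorem annihilation_powerVec (α q : ℝ) (J : H →L[ℂ] H) (e : H) (he : ‖e‖ = 1) (p : ℕ) :
    annihilation α q J e (powerVec e p)
      = jacobiCoeff q (α * inner ℂ e (J e)) p • powerVec e (p - 1) := by
  induction p with
  | zero => simp [powerVec, annihilation_vacuum, jacobiCoeff]
  | succ p ih =>
    have hee : inner ℂ e e = (1 : ℂ) := by simp [inner_self_eq_norm_sq_to_K, he]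
    rw [← creation_powerVec, annihilation_creation_apply, ih, qPow2N_powerVec, hee, jacobiCoeff]
    -- For `p = 0` the truncated `p - 1` is harmless because the coefficient in front vanishes.
    rcases p with _ | p
    · simp [jacobiCoeff, add_smul]
    · simp only [map_smul, creation_powerVec, add_tsub_cancel_right, smul_smul, one_smul, add_smul]

theorem deformedInner_vacuum_powerVec (α q : ℝ) (J : H →L[ℂ] H) (e : H) (p : ℕ) :
    deformedInner α q J vacuum (powerVec e p) = if p = 0 then 1 else 0 := by
  rcases p with _ | p
  · simp [powerVec, deformedInner_vacuum]
    simp [vacuumCoeff, vacuum]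
  · rw [← creation_powerVec, ← deformedInner_creation, annihilation_vacuum]
    simp [deformedInner]

end FockMoment

/-! ### Partial matchings -/

section Matchings

variable {m : ℕ}

/-- Involutions of `Fin m` that fix all points `≥ n`: the partial matchings of the first `n`
points. -/
def matchings (m n : ℕ) : Finset (Fin m → Fin m) :=
  {σ | (∀ i, σ (σ i) = i) ∧ ∀ i : Fin m, n ≤ i.val → σ i = i}

/-- The unmatched points among the first `n`. -/
def opens (n : ℕ) (σ : Fin m → Fin m) : Finset (Fin m) := {i | i.val < n ∧ σ i = i}

/-- The contribution of the arc that closes at `c`. -/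
noncomputable def arcWeight (q t : ℂ) (σ : Fin m → Fin m) (c : Fin m) : ℂ :=
  q ^ #{b | σ c < b ∧ b < c ∧ (σ b = b ∨ c < σ b)}
    * (1 + t * q ^ (2 * #{b | b < σ c ∧ (σ b = b ∨ c < σ b)}))

/-- The weight of a partial matching. -/
noncomputable def matchWeight (q t : ℂ) (σ : Fin m → Fin m) : ℂ :=
  ∏ c with σ c < c, arcWeight q t σ c

/-- Match the points `j` and `k`. -/
def join (σ : Fin m → Fin m) (j k : Fin m) (i : Fin m) : Fin m :=
  if i = j then k else if i = k then j else σ i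

/-- Unmatch the points `j` and `k`. -/
def unjoin (σ : Fin m → Fin m) (j k : Fin m) (i : Fin m) : Fin m :=
  if i = j then j else if i = k then k else σ i

theorem mem_matchings {n : ℕ} {σ : Fin m → Fin m} :
    σ ∈ matchings m n ↔ (∀ i, σ (σ i) = i) ∧ ∀ i : Fin m, n ≤ i.val → σ i = i := by
  simp [matchings]

theorem mem_opens {n : ℕ} {σ : Fin m → Fin m} {i : Fin m} :
    i ∈ opens n σ ↔ i.val < n ∧ σ i = i := by
  simp [opens]

theorem lt_of_mem_matchings {n : ℕ} {σ : Fin m → Fin m} (hσ : σ ∈ matchings m n) {i : Fin m}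
    (h : σ i ≠ i) : i.val < n ∧ (σ i).val < n := by
  rw [mem_matchings] at hσ
  refine ⟨?_, ?_⟩
  · by_contra h'
    exact h (hσ.2 i (by omega))
  · by_contra h'
    have := hσ.2 (σ i) (by omega)
    rw [hσ.1] at this
    exact h this.symm

/-- The new arc closes after all the others, so the old arcs keep their weights and the new one sees
the points still open at time `k`. -/
theorem matchWeight_join (q t : ℂ) {σ : Fin m → Fin m} {k : Fin m}
    (hσ : σ ∈ matchings m k) {j : Fin m} (hj : j ∈ opens k σ) :
    matchWeight q t (join σ j k)
      = matchWeight q t σ * (q ^ #{b ∈ opens k σ | j < b}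
          * (1 + t * q ^ (2 * #{b ∈ opens k σ | b < j}))) := by
  have hlt := @lt_of_mem_matchings _ _ _ hσ
  rw [mem_opens] at hj
  rw [mem_matchings] at hσ
  obtain ⟨hjk, hjj⟩ := hj
  have hjk' : j < k := hjk
  have hkk : σ k = k := hσ.2 k le_rfl
  have hset : univ.filter (fun c => join σ j k c < c)
      = insert k (univ.filter (fun c => σ c < c)) := by
    ext c
    simp only [mem_filter, mem_univ, true_and, mem_insert]
    simp only [join]
    split_ifs with h1 h2
    · subst h1
      simp [hjj, hjk'.not_gt, hjk'.ne]
    · subst h2; simp [hjk']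
    · simp [h2]
  rw [matchWeight, hset, prod_insert (by simp [hkk]), mul_comm, matchWeight]
  -- Arcs of `σ` end before `k`, so a point open at time `k` is an unmatched one other than `j`.
  have hopen : ∀ b : Fin m, b < k → ((join σ j k b = b ∨ k < join σ j k b) ↔ b ≠ j ∧ σ b = b) := by
    intro b hb
    simp only [join]
    split_ifs with h1 h2
    · subst h1; simp [hb.ne']
    · exact absurd h2 hb.ne
    · have : ¬ k < σ b := by
        intro h
        have := (@hlt b (by intro h'; rw [h'] at h; exact absurd h hb.not_gt)).2
        omega
      simp [this, h1]
  congr 1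
  · refine prod_congr rfl fun c hc => ?_
    simp only [mem_filter, mem_univ, true_and] at hc
    have hck : c < k := (hlt hc.ne).1
    have hcj : c ≠ j := by rintro rfl; exact absurd hjj hc.ne
    have h1 : join σ j k c = σ c := by simp [join, hck.ne, hcj]
    -- At an earlier closing time `c` the point `j` is open either way: fixed by `σ`, or joined to
    -- `k > c`.
    have h2 : ∀ b : Fin m, b < c →
        ((join σ j k b = b ∨ c < join σ j k b) ↔ (σ b = b ∨ c < σ b)) := by
      intro b hb
      simp only [join]
      split_ifs with h1 h2
      · subst h1; simp [hjj, hck]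
      · exact absurd h2 (hb.trans hck).ne
      · rfl
    rw [arcWeight, arcWeight, h1]
    congr 2
    · congr 1
      ext b
      simp only [mem_filter, mem_univ, true_and]
      constructor
      · rintro ⟨a1, a2, a3⟩; exact ⟨a1, a2, (h2 b a2).1 a3⟩
      · rintro ⟨a1, a2, a3⟩; exact ⟨a1, a2, (h2 b a2).2 a3⟩
    · congr 3
      congr 1
      ext b
      simp only [mem_filter, mem_univ, true_and]
      constructor
      · rintro ⟨a1, a2⟩; exact ⟨a1, (h2 b (a1.trans hc)).1 a2⟩
      · rintro ⟨a1, a2⟩; exact ⟨a1, (h2 b (a1.trans hc)).2 a2⟩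
  · have h1 : join σ j k k = j := by simp [join, hjk'.ne']
    rw [arcWeight, h1]
    congr 2
    · congr 1
      ext b
      simp only [mem_filter, mem_univ, true_and, mem_opens]
      constructor
      · rintro ⟨a1, a2, a3⟩; exact ⟨⟨a2, ((hopen b a2).1 a3).2⟩, a1⟩
      · rintro ⟨⟨a2, a3⟩, a1⟩; exact ⟨a1, a2, (hopen b a2).2 ⟨a1.ne', a3⟩⟩
    · congr 3
      congr 1
      ext b
      simp only [mem_filter, mem_univ, true_and, mem_opens]
      constructor
      · rintro ⟨a1, a2⟩
        exact ⟨⟨a1.trans hjk', ((hopen b (a1.trans hjk')).1 a2).2⟩, a1⟩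
      · rintro ⟨⟨a2, a3⟩, a1⟩; exact ⟨a1, (hopen b a2).2 ⟨a1.ne, a3⟩⟩

theorem opens_succ_of_mem {σ : Fin m → Fin m} {k : Fin m} (hσ : σ ∈ matchings m k) :
    #(opens (k + 1) σ) = #(opens k σ) + 1 := by
  have : opens (k + 1) σ = insert k (opens k σ) := by
    ext i
    rw [mem_matchings] at hσ
    simp only [mem_opens, mem_insert]
    constructor
    · rintro ⟨h1, h2⟩
      by_cases h : i = k
      · exact Or.inl h
      · exact Or.inr ⟨by omega, h2⟩
    · rintro (rfl | ⟨h1, h2⟩)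
      · exact ⟨by omega, hσ.2 _ le_rfl⟩
      · exact ⟨by omega, h2⟩
  rw [this, card_insert_of_notMem (by simp [mem_opens])]

theorem opens_succ_join {σ : Fin m → Fin m} {k j : Fin m}
    (hj : j ∈ opens k σ) : #(opens (k + 1) (join σ j k)) = #(opens k σ) - 1 := by
  have : opens (k + 1) (join σ j k) = (opens k σ).erase j := by
    ext i
    rw [mem_opens] at hj
    simp only [mem_opens, mem_erase, join]
    split_ifs with h1 h2
    · subst h1
      have : k ≠ i := by rintro rfl; omega
      simp [this]
    · subst h2
      have : j ≠ i := by rintro rfl; omega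
      simp [this]
    · constructor
      · rintro ⟨a, b⟩; exact ⟨h1, by omega, b⟩
      · rintro ⟨-, a, b⟩; exact ⟨by omega, b⟩
  rw [this, card_erase_of_mem hj]

/-- The point `k` either stays unmatched or is matched to an earlier open point; `unjoin` undoes the
second choice. -/
theorem sum_matchings_succ {M : Type*} [AddCommMonoid M] (k : Fin m) (F : (Fin m → Fin m) → M) :
    ∑ σ ∈ matchings m (k + 1), F σ
      = ∑ σ ∈ matchings m k, (F σ + ∑ j ∈ opens k σ, F (join σ j k)) := by
  rw [sum_add_distrib, ← sum_filter_add_sum_filter_not (matchings m (k + 1)) (fun σ => σ k = k)]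
  congr 1
  · refine sum_congr ?_ fun _ _ => rfl
    ext σ
    simp only [mem_filter, mem_matchings]
    constructor
    · rintro ⟨⟨h1, h2⟩, h3⟩
      refine ⟨h1, fun i hi => ?_⟩
      by_cases h : i = k
      · rw [h, h3]
      · exact h2 i (by omega)
    · rintro ⟨h1, h2⟩
      exact ⟨⟨h1, fun i hi => h2 i (by omega)⟩, h2 k le_rfl⟩
  · rw [sum_sigma']
    symm
    refine sum_bij' (i := fun p _ => join p.1 p.2 k)
      (j := fun τ _ => ⟨unjoin τ (τ k) k, τ k⟩) ?_ ?_ ?_ ?_ ?_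
    · rintro ⟨σ, j⟩ h
      simp only [mem_sigma] at h
      obtain ⟨h1, h2⟩ := h
      rw [mem_matchings] at h1
      rw [mem_opens] at h2
      have hkk := h1.2 k le_rfl
      have hne : j ≠ k := by rintro rfl; omega
      simp only [mem_filter, mem_matchings]
      refine ⟨⟨fun i => ?_, fun i hi => ?_⟩, ?_⟩
      · have := h1.1 i
        simp only [join]
        grind
      · have := h1.2 i (by omega)
        have hij : i ≠ j := by rintro rfl; omega
        have hik : i ≠ k := by rintro rfl; omega
        simp [join, hij, hik, this]
      · simp [join, hne.symm, hne]
    · intro τ h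
      simp only [mem_filter, mem_matchings] at h
      obtain ⟨⟨h1, h2⟩, h3⟩ := h
      have hlt : (τ k).val < k := by
        have := (lt_of_mem_matchings (mem_matchings.2 ⟨h1, h2⟩) h3).2
        have h4 : (τ k).val ≠ k := fun h => h3 (Fin.ext h)
        omega
      simp only [mem_sigma, mem_matchings, mem_opens]
      refine ⟨⟨fun i => ?_, fun i hi => ?_⟩, hlt, by simp [unjoin]⟩
      · have := h1 i
        have := h1 k
        simp only [unjoin]
        grind
      · simp only [unjoin]
        split_ifs with a b
        · exact a.symm
        · exact b.symm
        · exact h2 i (by have : i.val ≠ k := fun h => b (Fin.ext h); omega)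
    · rintro ⟨σ, j⟩ h
      simp only [mem_sigma, mem_matchings, mem_opens] at h
      have hkk := h.1.2 k le_rfl
      have hne : j ≠ k := by rintro rfl; omega
      have e1 : join σ j k k = j := by simp [join, hne.symm]
      simp only [e1, Sigma.mk.injEq, heq_eq_eq, and_true]
      funext i
      simp only [unjoin, join]
      grind
    · intro τ h
      simp only [mem_filter, mem_matchings] at h
      have := h.1.1 k
      funext i
      simp only [unjoin, join]
      grind
    · intro p _; rfl

theorem matchings_zero : matchings m 0 = {id} := by
  ext σ
  simp only [mem_matchings, mem_singleton]
  constructor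
  · rintro ⟨-, h⟩; funext i; exact h i (Nat.zero_le _)
  · rintro rfl; simp

variable {H : Type*} [NormedAddCommGroup H] [InnerProductSpace ℂ H]

/-- Each application of `G` treats one more point: creation leaves it open, annihilation closes an
open point with it. The ambient `m` stays fixed so that the type of `σ` survives the induction. -/
theorem gaussian_pow_vacuum (α q : ℝ) (J : H →L[ℂ] H) (e : H) (he : ‖e‖ = 1) (n : ℕ)
    (hn : n ≤ m) :
    (gaussian α q J e ^ n) vacuum = ∑ σ ∈ matchings m n,
      matchWeight q (α * inner ℂ e (J e)) σ • powerVec e #(opens n σ) := by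
  induction n with
  | zero => simp [matchings_zero, matchWeight, opens, powerVec]
  | succ n ih =>
    have key := sum_matchings_succ (⟨n, hn⟩ : Fin m) fun σ =>
      matchWeight q (α * inner ℂ e (J e)) σ • powerVec e #(opens (n + 1) σ)
    simp only at key
    rw [key, pow_succ', Module.End.mul_apply, ih (by omega), map_sum]
    refine sum_congr rfl fun σ hσ => ?_
    rw [map_smul, gaussian, LinearMap.add_apply, creation_powerVec,
      annihilation_powerVec α q J e he, add_comm, smul_add]
    congr 1
    · rw [opens_succ_of_mem (k := ⟨n, hn⟩) hσ]
    · rw [← sum_rank_eq_jacobiCoeff, sum_smul, smul_sum]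
      refine sum_congr rfl fun j hj => ?_
      rw [matchWeight_join (k := ⟨n, hn⟩) _ _ hσ hj, opens_succ_join (k := ⟨n, hn⟩) hj, smul_smul]

/-- Pairing with the vacuum kills every matching that leaves a point open. -/
theorem vacuumMoment_eq_sum_matchings (α q : ℝ) (J : H →L[ℂ] H) (e : H) (he : ‖e‖ = 1) (m : ℕ) :
    vacuumMoment α q J e m
      = ∑ σ : Fin m → Fin m with (∀ i, σ (σ i) = i) ∧ ∀ i, σ i ≠ i,
        matchWeight q (α * inner ℂ e (J e)) σ := by
  have hlin : ∀ (s : Finset (Fin m → Fin m)) (a : (Fin m → Fin m) → ℂ)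
      (v : (Fin m → Fin m) → Fock H), deformedInner α q J vacuum (∑ i ∈ s, a i • v i)
        = ∑ i ∈ s, a i * deformedInner α q J vacuum (v i) := by
    intro s a v
    simp [deformedInner, LinearMap.sum_apply]
  rw [vacuumMoment, gaussian_pow_vacuum (m := m) α q J e he m le_rfl, hlin]
  simp only [deformedInner_vacuum_powerVec, mul_ite, mul_one, mul_zero]
  rw [← sum_filter]
  refine sum_congr ?_ fun _ _ => rfl
  ext σ
  simp only [mem_filter, mem_matchings, mem_univ, true_and, card_eq_zero, opens,
    filter_eq_empty_iff, forall_const, Fin.is_lt]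
  constructor
  · rintro ⟨⟨h1, -⟩, h2⟩; exact ⟨h1, h2⟩
  · rintro ⟨h1, h2⟩; exact ⟨⟨h1, fun i hi => absurd i.2 (by omega)⟩, h2⟩

end Matchings

end TypeB

namespace TypeB

open Finset

/-! ### Pair partitions through the end points of their blocks -/

section PairPartitions

instance decidableCrosses {m : ℕ} (V W : Finset (Fin m)) : Decidable (Crosses V W) := by
  unfold Crosses; infer_instance

instance decidableNests {m : ℕ} (V W : Finset (Fin m)) : Decidable (Nests V W) := by
  unfold Nests; infer_instance

variable {m : ℕ} (π : PairPartition m)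

theorem PairPartition.nonempty (V : π.1.parts) : (V : Finset (Fin m)).Nonempty :=
  π.1.nonempty_of_mem_parts V.2

/-- The left end point of a block. -/
def lo (V : π.1.parts) : Fin m := (V : Finset (Fin m)).min' (π.nonempty V)

/-- The right end point of a block. -/
def hi (V : π.1.parts) : Fin m := (V : Finset (Fin m)).max' (π.nonempty V)

/-- The block of a point. -/
def blk (p : Fin m) : π.1.parts := ⟨π.1.part p, (π.1.part_mem).2 (mem_univ p)⟩

variable {π}

theorem lo_mem (V : π.1.parts) : lo π V ∈ (V : Finset (Fin m)) := min'_mem _ _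

theorem hi_mem (V : π.1.parts) : hi π V ∈ (V : Finset (Fin m)) := max'_mem _ _

theorem lo_lt_hi (V : π.1.parts) : lo π V < hi π V :=
  min'_lt_max'_of_card _ (by rw [π.2 V V.2]; norm_num)

theorem coe_eq_pair (V : π.1.parts) : (V : Finset (Fin m)) = {lo π V, hi π V} := by
  symm
  apply eq_of_subset_of_card_le
  · intro x hx
    rcases mem_insert.1 hx with rfl | hx
    · exact lo_mem V
    · rw [mem_singleton.1 hx]; exact hi_mem V
  · rw [π.2 V V.2, card_pair (lo_lt_hi V).ne]

theorem mem_iff_eq_lo_or_hi {V : π.1.parts} {p : Fin m} :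
    p ∈ (V : Finset (Fin m)) ↔ p = lo π V ∨ p = hi π V := by
  conv_lhs => rw [coe_eq_pair V]
  simp

theorem mem_blk (p : Fin m) : p ∈ (blk π p : Finset (Fin m)) :=
  (π.1.mem_part_self).2 (mem_univ p)

theorem blk_eq_iff {p : Fin m} {V : π.1.parts} : blk π p = V ↔ p ∈ (V : Finset (Fin m)) := by
  rw [Subtype.ext_iff]
  exact π.1.part_eq_iff_mem V.2

theorem blk_eq_iff_lo_or_hi {p : Fin m} {V : π.1.parts} :
    blk π p = V ↔ p = lo π V ∨ p = hi π V := by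
  rw [blk_eq_iff, mem_iff_eq_lo_or_hi]

@[simp] theorem blk_lo (V : π.1.parts) : blk π (lo π V) = V := blk_eq_iff.2 (lo_mem V)

@[simp] theorem blk_hi (V : π.1.parts) : blk π (hi π V) = V := blk_eq_iff.2 (hi_mem V)

theorem eq_lo_or_hi_blk (p : Fin m) : p = lo π (blk π p) ∨ p = hi π (blk π p) :=
  mem_iff_eq_lo_or_hi.1 (mem_blk p)

theorem lo_injective : Function.Injective (lo π) := fun V W h => by
  rw [← blk_lo V, h, blk_lo]

theorem hi_injective : Function.Injective (hi π) := fun V W h => by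
  rw [← blk_hi V, h, blk_hi]

theorem lo_ne_hi (V W : π.1.parts) : lo π V ≠ hi π W := fun h => by
  have : V = W := by rw [← blk_lo V, h, blk_hi]
  subst this
  exact (lo_lt_hi V).ne h

theorem two_mul_card_parts : 2 * Fintype.card π.1.parts = m := by
  have h := π.1.sum_card_parts
  rw [sum_congr rfl fun V hV => π.2 V hV, sum_const, card_univ, Fintype.card_fin,
    smul_eq_mul] at h
  rw [Fintype.card_coe]
  omega

theorem crosses_iff {V W : π.1.parts} : Crosses (V : Finset (Fin m)) (W : Finset (Fin m)) ↔
    lo π V < lo π W ∧ lo π W < hi π V ∧ hi π V < hi π W := by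
  constructor
  · rintro ⟨i, hi', j, hj, k, hk, l, hl, h1, h2, h3⟩
    have := lo_lt_hi V
    have := lo_lt_hi W
    rw [mem_iff_eq_lo_or_hi] at hi' hj hk hl
    grind
  · rintro ⟨h1, h2, h3⟩
    exact ⟨_, lo_mem V, _, hi_mem V, _, lo_mem W, _, hi_mem W, h1, h2, h3⟩

theorem nests_iff {V W : π.1.parts} : Nests (V : Finset (Fin m)) (W : Finset (Fin m)) ↔
    lo π V < lo π W ∧ hi π W < hi π V := by
  constructor
  · rintro ⟨i, hi', j, hj, h⟩
    have h1 := h _ (lo_mem W)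
    have h2 := h _ (hi_mem W)
    have := lo_lt_hi V
    rw [mem_iff_eq_lo_or_hi] at hi' hj
    grind
  · rintro ⟨h1, h2⟩
    refine ⟨_, lo_mem V, _, hi_mem V, fun k hk => ?_⟩
    have := lo_lt_hi W
    rw [mem_iff_eq_lo_or_hi] at hk
    grind

/-- The fixed-point-free involution attached to a pair partition. -/
def partner (π : PairPartition m) (p : Fin m) : Fin m :=
  if p = lo π (blk π p) then hi π (blk π p) else lo π (blk π p)

@[simp] theorem partner_lo (V : π.1.parts) : partner π (lo π V) = hi π V := by simp [partner]

@[simp] theorem partner_hi (V : π.1.parts) : partner π (hi π V) = lo π V := by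
  simp [partner, (lo_lt_hi V).ne']

theorem forall_lo_hi {P : Fin m → Prop} (π : PairPartition m) (h1 : ∀ V, P (lo π V))
    (h2 : ∀ V, P (hi π V)) (p : Fin m) : P p := by
  rcases eq_lo_or_hi_blk (π := π) p with h | h
  · rw [h]; exact h1 _
  · rw [h]; exact h2 _

theorem partner_partner (p : Fin m) : partner π (partner π p) = p := by
  revert p
  exact forall_lo_hi π (by simp) (by simp)

theorem partner_ne (p : Fin m) : partner π p ≠ p := by
  revert p
  exact forall_lo_hi π (by simp [(lo_lt_hi _).ne']) (by simp [(lo_lt_hi _).ne])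

theorem mem_part_iff_partner {p x : Fin m} : x ∈ π.1.part p ↔ x = p ∨ x = partner π p := by
  change x ∈ (blk π p : Finset (Fin m)) ↔ _
  refine forall_lo_hi (P := fun p => x ∈ (blk π p : Finset (Fin m)) ↔ x = p ∨ x = partner π p) π
    (fun V => ?_) (fun V => ?_) p
  · simp [mem_iff_eq_lo_or_hi]
  · simp [mem_iff_eq_lo_or_hi, or_comm]

theorem PairPartition.ext_of_part {π ρ : PairPartition m}
    (h : ∀ p, π.1.part p = ρ.1.part p) : π = ρ := by
  apply Subtype.ext
  apply Finpartition.ext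
  have key : ∀ τ : PairPartition m, τ.1.parts = univ.image τ.1.part := by
    intro τ
    ext V
    simp only [mem_image, mem_univ, true_and]
    constructor
    · intro hV
      obtain ⟨x, hx⟩ := τ.1.nonempty_of_mem_parts hV
      exact ⟨x, τ.1.part_eq_of_mem hV hx⟩
    · rintro ⟨x, rfl⟩
      exact τ.1.part_mem.2 (mem_univ x)
  rw [key, key]
  exact image_congr fun p _ => h p

theorem partner_injective : Function.Injective (partner (m := m)) := by
  intro π ρ h
  refine PairPartition.ext_of_part fun p => ?_
  ext x
  rw [mem_part_iff_partner, mem_part_iff_partner, h]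

/-- Serves twice: for the orbits of an involution and for the positions of a word with equal site.
-/
theorem exists_pairPartition_of_equivalence (r : Setoid (Fin m))
    (h2 : ∀ p, ∃ p', p' ≠ p ∧ ∀ x, r p x ↔ x = p ∨ x = p') :
    ∃ π : PairPartition m, ∀ p x, x ∈ π.1.part p ↔ r p x := by
  classical
  refine ⟨⟨Finpartition.ofSetoid r, fun V hV => ?_⟩, fun p x =>
    Finpartition.mem_part_ofSetoid_iff_rel⟩
  obtain ⟨p, hp⟩ := (Finpartition.ofSetoid r).nonempty_of_mem_parts hV
  obtain ⟨p', hne, hp'⟩ := h2 p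
  rw [← (Finpartition.ofSetoid r).part_eq_of_mem hV hp]
  have : (Finpartition.ofSetoid r).part p = {p, p'} := by
    ext x
    rw [Finpartition.mem_part_ofSetoid_iff_rel, hp']
    simp
  rw [this, card_pair hne.symm]

theorem exists_partner_eq {σ : Fin m → Fin m} (h1 : ∀ i, σ (σ i) = i) (h2 : ∀ i, σ i ≠ i) :
    ∃ π : PairPartition m, partner π = σ := by
  let r : Setoid (Fin m) :=
    { r := fun a b => b = a ∨ b = σ a
      iseqv := ⟨fun a => Or.inl rfl, fun {a b} h => by
          rcases h with rfl | rfl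
          · exact Or.inl rfl
          · exact Or.inr (h1 _).symm, fun {a b c} h h' => by
          rcases h with rfl | rfl
          · exact h'
          · rcases h' with rfl | rfl
            · exact Or.inr rfl
            · exact Or.inl (h1 _)⟩ }
  obtain ⟨π, hπ⟩ := exists_pairPartition_of_equivalence r fun p => ⟨σ p, h2 p, fun x => Iff.rfl⟩
  refine ⟨π, funext fun p => ?_⟩
  have h := (hπ p (partner π p)).1 (mem_part_iff_partner.2 (Or.inr rfl))
  rcases h with h | h
  · exact absurd h (partner_ne p)
  · exact h

/-- The points open when `V` closes are left end points of blocks that close later. Those after `lo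
V` belong to blocks crossed by `V`, those before it to blocks that nest `V`. -/
theorem arcWeight_partner (q t : ℂ) (V : π.1.parts) :
    arcWeight q t (partner π) (hi π V)
      = q ^ #{W : π.1.parts | Crosses (V : Finset (Fin m)) (W : Finset (Fin m))}
        * (1 + t * q ^ (2 * #{W : π.1.parts | Nests (W : Finset (Fin m)) (V : Finset (Fin m))})) := by
  have hopen : ∀ b, b < hi π V → (partner π b = b ∨ hi π V < partner π b) →
      ∃ W, b = lo π W ∧ hi π V < hi π W := by
    refine forall_lo_hi π (fun W hb h => ?_) (fun W hb h => ?_)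
    · rw [partner_lo] at h
      exact ⟨W, rfl, h.resolve_left (lo_lt_hi W).ne'⟩
    · rw [partner_hi] at h
      have := lo_lt_hi W
      rcases h with h | h
      · exact absurd h this.ne
      · exact absurd (h.trans (this.trans hb)) (lt_irrefl _)
  rw [arcWeight, partner_hi]
  congr 2
  · symm
    refine card_bij (fun W _ => lo π W) ?_ (fun _ _ _ _ h => lo_injective h) ?_
    · intro W hW
      rw [mem_filter, crosses_iff] at hW
      simp only [mem_filter, mem_univ, true_and, partner_lo]
      exact ⟨hW.2.1, hW.2.2.1, Or.inr hW.2.2.2⟩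
    · intro b hb
      simp only [mem_filter, mem_univ, true_and] at hb
      obtain ⟨W, rfl, hW⟩ := hopen b hb.2.1 hb.2.2
      exact ⟨W, by rw [mem_filter, crosses_iff]; exact ⟨mem_univ _, hb.1, hb.2.1, hW⟩, rfl⟩
  · congr 3
    symm
    refine card_bij (fun W _ => lo π W) ?_ (fun _ _ _ _ h => lo_injective h) ?_
    · intro W hW
      rw [mem_filter, nests_iff] at hW
      simp only [mem_filter, mem_univ, true_and, partner_lo]
      exact ⟨hW.2.1, Or.inr hW.2.2⟩
    · intro b hb
      simp only [mem_filter, mem_univ, true_and] at hb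
      obtain ⟨W, rfl, hW⟩ := hopen b (hb.1.trans (lo_lt_hi V)) hb.2
      exact ⟨W, by rw [mem_filter, nests_iff]; exact ⟨mem_univ _, hb.1, hW⟩, rfl⟩

theorem matchWeight_partner (q t : ℂ) (π : PairPartition m) :
    matchWeight q t (partner π) = ∏ V : π.1.parts,
      (q ^ #{W : π.1.parts | Crosses (V : Finset (Fin m)) (W : Finset (Fin m))}
        * (1 + t * q ^ (2 * #{W : π.1.parts | Nests (W : Finset (Fin m)) (V : Finset (Fin m))}))) := by
  rw [matchWeight]
  symm
  refine prod_bij (fun V _ => hi π V) ?_ (fun _ _ _ _ h => hi_injective h) ?_ ?_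
  · intro V _
    simp [lo_lt_hi V]
  · refine forall_lo_hi π (fun V h => ?_) (fun V h => ⟨V, mem_univ _, rfl⟩)
    simp only [mem_filter, mem_univ, true_and, partner_lo] at h
    exact absurd h (lo_lt_hi V).not_gt
  · intro V _
    rw [arcWeight_partner]

theorem natCard_pairs {ι : Type*} [Fintype ι] (P : ι → ι → Prop) [∀ a b, Decidable (P a b)] :
    Nat.card {p : ι × ι // P p.1 p.2} = ∑ a, #{b | P a b} := by
  rw [Nat.card_eq_fintype_card, Fintype.card_subtype]
  simp only [card_filter]
  rw [Fintype.sum_prod_type]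

theorem Cr_eq_sum (π : PairPartition m) :
    Cr π = ∑ V : π.1.parts,
      #{W : π.1.parts | Crosses (V : Finset (Fin m)) (W : Finset (Fin m))} := by
  classical
  rw [Cr]
  convert natCard_pairs (fun V W : π.1.parts => Crosses (V : Finset (Fin m)) (W : Finset (Fin m)))

theorem Nest_eq_sum (π : PairPartitionB m) :
    Nest π = ∑ V : π.1.1.parts, if π.2 V = -1 then
      #{W : π.1.1.parts | Nests (W : Finset (Fin m)) (V : Finset (Fin m))} else 0 := by
  classical
  rw [Nest]
  have h := natCard_pairs (fun V W : π.1.1.parts =>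
    π.2 V = -1 ∧ Nests (W : Finset (Fin m)) (V : Finset (Fin m)))
  -- The pairs are swapped so that the count is grouped by the inner, coloured block.
  have h' := Nat.card_congr ((Equiv.prodComm π.1.1.parts π.1.1.parts).subtypeEquiv
    (p := fun p => π.2 p.2 = -1 ∧ Nests (p.1 : Finset (Fin m)) (p.2 : Finset (Fin m)))
    (q := fun p => π.2 p.1 = -1 ∧ Nests (p.2 : Finset (Fin m)) (p.1 : Finset (Fin m)))
    fun p => Iff.rfl)
  rw [h', h]
  refine sum_congr rfl fun V _ => ?_
  split_ifs with hV
  · simp [hV]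
  · simp [hV]

theorem NB_eq_card (π : PairPartitionB m) : NB π = #{V | π.2 V = -1} := by
  rw [NB, Nat.card_eq_fintype_card, Fintype.card_subtype]

/-- Expanding the product of the factors `1 + t q^(2s)` amounts to choosing a colour for each block:
`1` selects the summand `1`, `-1` the other. -/
theorem sum_colour_weight (q t : ℂ) (π : PairPartition m) :
    ∑ f : π.1.parts → ℤˣ, t ^ NB ⟨π, f⟩ * q ^ (Cr π + 2 * Nest ⟨π, f⟩)
      = matchWeight q t (partner π) := by
  rw [matchWeight_partner, prod_mul_distrib, prod_pow_eq_pow_sum, ← Cr_eq_sum]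
  have h : ∀ V : π.1.parts, (1 + t * q ^ (2 * #{W : π.1.parts |
      Nests (W : Finset (Fin m)) (V : Finset (Fin m))}))
      = ∑ s : ℤˣ, if s = -1 then t * q ^ (2 * #{W : π.1.parts |
      Nests (W : Finset (Fin m)) (V : Finset (Fin m))}) else 1 := by
    intro V
    rw [show (univ : Finset ℤˣ) = {1, -1} from rfl, sum_pair (by decide)]
    simp
  simp_rw [h]
  rw [Fintype.prod_sum, mul_sum]
  refine sum_congr rfl fun f _ => ?_
  rw [NB_eq_card, Nest_eq_sum, pow_add, mul_sum, ← prod_pow_eq_pow_sum, mul_left_comm]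
  congr 1
  rw [← prod_const, prod_filter, ← prod_mul_distrib]
  refine prod_congr rfl fun V _ => ?_
  simp only
  split_ifs <;> simp

variable {H : Type*} [NormedAddCommGroup H] [InnerProductSpace ℂ H]

theorem sum_pairPartitionB_eq_vacuumMoment (α q : ℝ) (J : H →L[ℂ] H) (e : H) (he : ‖e‖ = 1)
    (m : ℕ) :
    ∑ π : PairPartitionB m, (α : ℂ) ^ NB π * (q : ℂ) ^ (Cr π.1 + 2 * Nest π)
        * inner ℂ e (J e) ^ NB π
      = vacuumMoment α q J e m := by
  rw [vacuumMoment_eq_sum_matchings α q J e he, Fintype.sum_sigma]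
  refine sum_bij (fun π _ => partner π) ?_ (fun _ _ _ _ h => partner_injective h) ?_ ?_
  · intro π _
    simp only [mem_filter, mem_univ, true_and]
    exact ⟨partner_partner, partner_ne⟩
  · intro σ hσ
    simp only [mem_filter, mem_univ, true_and] at hσ
    obtain ⟨π, hπ⟩ := exists_partner_eq hσ.1 hσ.2
    exact ⟨π, mem_univ _, hπ⟩
  · intro π _
    rw [← sum_colour_weight]
    refine sum_congr rfl fun f _ => ?_
    rw [mul_pow]
    ring

end PairPartitions

end TypeB

namespace TypeB

open Finset

/-! ### Products of `2 × 2` matrices -/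

section TwoByTwo

/-- Only the top row of the partial products matters: it sits in column `0`, moves to column `1` at
`l`, collects the entries `d`, and returns at `r`. Taking `l` and `r` in `ℕ` lets them lie beyond
the prefix in the induction. -/
theorem prod_apply_pair {k : ℕ} (A : Fin k → Matrix (Fin 2) (Fin 2) ℝ) (d : Fin k → ℝ)
    (l r : ℕ) (hlr : l < r) (B C : Matrix (Fin 2) (Fin 2) ℝ)
    (hA : ∀ p : Fin k, p.val ≠ l → p.val ≠ r → A p = sigma (d p))
    (hl : ∀ p : Fin k, p.val = l → A p = B) (hr : ∀ p : Fin k, p.val = r → A p = C)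
    (hB : B 0 0 = 0) (hC : C 1 1 = 0) :
    ((List.ofFn A).prod 0 0 = if r < k then
        B 0 1 * C 1 0 * ∏ p : Fin k, (if l < p.val ∧ p.val < r then d p else 1)
      else if l < k then 0 else 1) ∧
    ((List.ofFn A).prod 0 1 = if r < k then 0 else if l < k then
        B 0 1 * ∏ p : Fin k, (if l < p.val ∧ p.val < r then d p else 1) else 0) := by
  induction k with
  | zero => simp
  | succ k ih =>
    obtain ⟨ih0, ih1⟩ := ih (fun p => A p.castSucc) (fun p => d p.castSucc)
      (fun p h1 h2 => hA _ h1 h2) (fun p h => hl _ h) (fun p h => hr _ h)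
    rw [List.ofFn_succ', List.concat_eq_append, List.prod_append, List.prod_singleton,
      Matrix.mul_apply, Matrix.mul_apply, Fin.sum_univ_two, Fin.sum_univ_two, ih0, ih1,
      Fin.prod_univ_castSucc]
    rcases lt_trichotomy k l with h | h | h
    · rw [hA (Fin.last k) (by simp; omega) (by simp; omega)]
      have h1 : ¬ r < k := by omega
      have h2 : ¬ l < k := by omega
      have h3 : ¬ r < k + 1 := by omega
      have h4 : ¬ l < k + 1 := by omega
      simp [h1, h2, h3, h4, sigma]
    · rw [hl (Fin.last k) (by simp [h])]
      have h1 : ¬ r < k := by omega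
      have h3 : ¬ r < k + 1 := by omega
      subst h
      have h5 : ∀ p : Fin k, ¬ k < p.val := fun p => by omega
      simp [h1, h3, hB, h5]
    · rcases lt_trichotomy k r with h' | h' | h'
      · rw [hA (Fin.last k) (by simp; omega) (by simp; omega)]
        have h1 : ¬ r < k := by omega
        have h3 : ¬ r < k + 1 := by omega
        have h4 : l < k + 1 := by omega
        simp [h1, h3, h4, h, h', sigma, mul_assoc]
      · rw [hr (Fin.last k) (by simp [h'])]
        subst h'
        have h4 : l < k + 1 := by omega
        simp only [lt_irrefl, h, if_true, if_false, hC, lt_add_one, h4]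
        simp only [Fin.val_castSucc, Fin.val_last, lt_irrefl, and_false, if_false]
        constructor <;> ring
      · rw [hA (Fin.last k) (by simp; omega) (by simp; omega)]
        have h1 : r < k + 1 := by omega
        have h2 : ¬ k < r := by omega
        simp [h1, h2, h', sigma]

theorem prod_apply_diag {k : ℕ} (A : Fin k → Matrix (Fin 2) (Fin 2) ℝ) (d : Fin k → ℝ)
    (hA : ∀ p : Fin k, A p = sigma (d p)) : (List.ofFn A).prod 0 0 = 1 := by
  -- Both special positions are placed past the end of the list.
  have := (prod_apply_pair A d k (k + 1) (by omega) 0 0 (fun p _ _ => hA p)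
    (fun p h => by omega) (fun p h => by omega) rfl rfl).1
  simpa using this

/-- Conjugation by `diag(1, -1)` fixes diagonal matrices and negates off-diagonal ones. It therefore
negates the product, yet it leaves the upper left entry unchanged. -/
theorem prod_apply_of_odd {k : ℕ} (A : Fin k → Matrix (Fin 2) (Fin 2) ℝ) (O : Finset (Fin k))
    (h0 : ∀ p ∈ O, A p 0 0 = 0 ∧ A p 1 1 = 0) (h1 : ∀ p ∉ O, A p 0 1 = 0 ∧ A p 1 0 = 0)
    (hO : Odd #O) : (List.ofFn A).prod 0 0 = 0 := by
  let D : Matrix (Fin 2) (Fin 2) ℝ := Matrix.diagonal ![1, -1]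
  have hD : D * D = 1 := by
    ext i j; fin_cases i <;> fin_cases j <;> simp [D]
  have key : ∀ {n : ℕ} (A : Fin n → Matrix (Fin 2) (Fin 2) ℝ) (ε : Fin n → ℝ),
      (∀ p, D * A p * D = ε p • A p) →
      D * (List.ofFn A).prod * D = (∏ p, ε p) • (List.ofFn A).prod := by
    intro n
    induction n with
    | zero => intro A ε _; simp [hD]
    | succ n ih =>
      intro A ε h
      rw [List.ofFn_succ, List.prod_cons, Fin.prod_univ_succ]
      calc D * (A 0 * (List.ofFn fun i => A i.succ).prod) * D
          = (D * A 0 * D) * (D * (List.ofFn fun i => A i.succ).prod * D) := by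
            simp only [mul_assoc]
            rw [← mul_assoc D D, hD, one_mul]
        _ = _ := by
            rw [h, ih _ (fun i => ε i.succ) fun p => h p.succ, smul_mul_smul_comm]
  have h := key A (fun p => if p ∈ O then -1 else 1) (fun p => by
    split_ifs with hp
    · obtain ⟨a, b⟩ := h0 p hp
      ext i j
      fin_cases i <;> fin_cases j <;>
        simp [D, Matrix.mul_diagonal, Matrix.diagonal_mul, Matrix.smul_apply, a, b]
    · obtain ⟨a, b⟩ := h1 p hp
      ext i j
      fin_cases i <;> fin_cases j <;>
        simp [D, Matrix.mul_diagonal, Matrix.diagonal_mul, Matrix.smul_apply, a, b])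
  have h00 := congrFun (congrFun h 0) 0
  rw [prod_ite_mem, prod_const, univ_inter, hO.neg_one_pow] at h00
  simp only [D, Matrix.mul_diagonal, Matrix.diagonal_mul, Matrix.smul_apply, smul_eq_mul,
    Matrix.cons_val_zero] at h00
  linarith

theorem abs_prod_apply_le {k : ℕ} (A : Fin k → Matrix (Fin 2) (Fin 2) ℝ) (B : ℝ) (hB : 1 ≤ B)
    (hA : ∀ p i j, |A p i j| ≤ B) (i j : Fin 2) : |(List.ofFn A).prod i j| ≤ (2 * B) ^ k := by
  induction k generalizing i j with
  | zero => fin_cases i <;> fin_cases j <;> simp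
  | succ k ih =>
    rw [List.ofFn_succ, List.prod_cons, Matrix.mul_apply, Fin.sum_univ_two]
    have h := ih (fun p => A p.succ) fun p => hA p.succ
    have hpos : 0 ≤ (2 * B) ^ k := by positivity
    calc _ ≤ |A 0 i 0| * |(List.ofFn fun i => A i.succ).prod 0 j|
          + |A 0 i 1| * |(List.ofFn fun i => A i.succ).prod 1 j| := by
          rw [← abs_mul, ← abs_mul]; exact abs_add_le _ _
      _ ≤ B * (2 * B) ^ k + B * (2 * B) ^ k := by
          gcongr
          · exact hA _ _ _
          · exact h _ _
          · exact hA _ _ _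
          · exact h _ _
      _ = _ := by ring

end TwoByTwo

/-! ### Moments of `Z_N` as sums over words -/

section Words

variable {N : ℕ}

/-- The tensor factor at the site `v` of `T_{N,i}^*`, `T_{N,i}`, `T'_{N,i}`, for the letter
`(i, 0)`, `(i, 1)`, `(i, 2)` respectively. -/
noncomputable def siteMat (Q R : ℕ → ℕ → ℝ) (Ψ : ℕ → ℝ) (x : Fin N × Fin 3) (v : Fin N) :
    Matrix (Fin 2) (Fin 2) ℝ :=
  if x.2 = 0 then
    (if v < x.1 then sigma (Q v x.1) else if v = x.1 then gamma 1 else sigma 1).transpose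
  else if x.2 = 1 then
    if v < x.1 then sigma (Q v x.1) else if v = x.1 then gamma 1 else sigma 1
  else
    if v < x.1 then sigma (R v x.1) else if v = x.1 then gamma (Ψ x.1)
      else sigma (Q v x.1 * R v x.1)

/-- The lower right entry of `siteMat` away from the site of the letter. -/
noncomputable def siteEntry (Q R : ℕ → ℕ → ℝ) (x : Fin N × Fin 3) (v : Fin N) : ℝ :=
  if x.2 = 2 then (if v < x.1 then R v x.1 else Q v x.1 * R v x.1)
  else (if v < x.1 then Q v x.1 else 1)

variable (Q R : ℕ → ℕ → ℝ) (Ψ : ℕ → ℝ)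

theorem transpose_sigma (x : ℝ) : (sigma x).transpose = sigma x := by
  ext i j; fin_cases i <;> fin_cases j <;> simp [sigma]

theorem siteMat_of_ne {x : Fin N × Fin 3} {v : Fin N} (h : v ≠ x.1) :
    siteMat Q R Ψ x v = sigma (siteEntry Q R x v) := by
  obtain ⟨i, c⟩ := x
  simp only at h
  fin_cases c <;> simp only [siteMat, siteEntry, h, if_false] <;>
    split_ifs <;> simp_all [transpose_sigma]

theorem siteMat_self_diag (x : Fin N × Fin 3) (j : Fin 2) : siteMat Q R Ψ x x.1 j j = 0 := by
  obtain ⟨i, c⟩ := x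
  fin_cases c <;> fin_cases j <;> simp [siteMat, gamma]

theorem siteMat_self_zero_one (x : Fin N × Fin 3) :
    siteMat Q R Ψ x x.1 0 1 = if x.2 = 0 then 1 else 0 := by
  obtain ⟨i, c⟩ := x
  fin_cases c <;> simp [siteMat, gamma]

theorem siteMat_self_one_zero (x : Fin N × Fin 3) :
    siteMat Q R Ψ x x.1 1 0 = if x.2 = 0 then 0 else if x.2 = 1 then 1 else Ψ x.1 := by
  obtain ⟨i, c⟩ := x
  fin_cases c <;> simp [siteMat, gamma]

theorem Z_eq_sum : Z N Q R Ψ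
    = (Real.sqrt N)⁻¹ • ∑ x : Fin N × Fin 3, PiTensorProduct.tprod ℝ (siteMat Q R Ψ x) := by
  have h0 : ∀ i : Fin N, adj N (T N Q i) = PiTensorProduct.tprod ℝ (siteMat Q R Ψ (i, 0)) := by
    intro i
    rw [adj, T, PiTensorProduct.map_tprod]
    congr 1
  rw [Z, S, S', map_smul, map_sum, ← smul_add, ← smul_add, ← sum_add_distrib, ← sum_add_distrib,
    Fintype.sum_prod_type]
  congr 1
  refine sum_congr rfl fun i _ => ?_
  rw [Fin.sum_univ_three, h0]
  rw [add_comm (T N Q i)]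
  rfl

theorem sum_pow_eq_sum_words {A ι : Type*} [Semiring A] [Fintype ι] (a : ι → A) (k : ℕ) :
    (∑ i, a i) ^ k = ∑ w : Fin k → ι, (List.ofFn fun p => a (w p)).prod := by
  induction k with
  | zero => simp
  | succ k ih =>
    rw [pow_succ', ih, ← (Fin.consEquiv fun _ : Fin (k + 1) => ι).sum_comp, Fintype.sum_prod_type,
      sum_mul_sum]
    refine sum_congr rfl fun i _ => sum_congr rfl fun w _ => ?_
    simp [List.ofFn_succ, Fin.consEquiv]

/-- The value of `φ_N` on a word in the letters `T_{N,i}^*`, `T_{N,i}`, `T'_{N,i}`. -/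
noncomputable def wordWeight {k : ℕ} (w : Fin k → Fin N × Fin 3) : ℝ :=
  ∏ v, (List.ofFn fun p => siteMat Q R Ψ (w p) v).prod 0 0

/-- Pure tensors multiply site by site, and `phi` is multiplicative over the sites of a pure tensor.
-/
theorem phi_Z_pow (k : ℕ) : phi N (Z N Q R Ψ ^ k)
    = (Real.sqrt N)⁻¹ ^ k * ∑ w : Fin k → Fin N × Fin 3, wordWeight Q R Ψ w := by
  have hpow : ∀ (c : ℝ) (x : Alg N), (c • x) ^ k = c ^ k • x ^ k := fun c x => by
    have hs : ∀ (c : ℝ) (x : Alg N), c • x = algebraMap ℝ (Alg N) c * x :=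
      fun c x => Algebra.smul_def c x
    rw [hs, hs]
    rw [(show Commute (algebraMap ℝ (Alg N) c) x from Algebra.commutes c x).mul_pow, map_pow]
  rw [Z_eq_sum, hpow, map_smul, smul_eq_mul, sum_pow_eq_sum_words, map_sum]
  congr 1
  refine sum_congr rfl fun w _ => ?_
  have h : (List.ofFn fun p => PiTensorProduct.tprod ℝ (siteMat Q R Ψ (w p))).prod
      = PiTensorProduct.tprod ℝ (List.ofFn fun p => siteMat Q R Ψ (w p)).prod := by
    have := map_list_prod
      (PiTensorProduct.tprodMonoidHom (R := ℝ) (A := fun _ : Fin N => Matrix (Fin 2) (Fin 2) ℝ))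
      (List.ofFn fun p => siteMat Q R Ψ (w p))
    rw [List.map_ofFn] at this
    exact this.symm
  rw [h, phi, PiTensorProduct.lift.tprod, wordWeight]
  simp only [MultilinearMap.compLinearMap_apply, MultilinearMap.mkPiAlgebra_apply,
    Matrix.entryLinearMap_apply]
  refine prod_congr rfl fun v _ => ?_
  rw [Pi.list_prod_apply, List.map_ofFn]
  rfl

end Words

end TypeB

namespace TypeB

open Finset

/-! ### Words whose sites pair up their positions -/

section PairWords

variable {N k : ℕ} (Q R : ℕ → ℕ → ℝ) (Ψ : ℕ → ℝ)

theorem wordWeight_site_eq_one {w : Fin k → Fin N × Fin 3} {v : Fin N}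
    (hv : ∀ p, (w p).1 ≠ v) : (List.ofFn fun p => siteMat Q R Ψ (w p) v).prod 0 0 = 1 :=
  prod_apply_diag _ (fun p => siteEntry Q R (w p) v) fun p => siteMat_of_ne Q R Ψ (hv p).symm

/-- Only `T*` has a nonzero upper right entry at its own site, so it must come first; the second
letter must be `T` or `T'`. -/
theorem wordWeight_site_pair {w : Fin k → Fin N × Fin 3} {v : Fin N} {l r : Fin k} (hlr : l < r)
    (hv : ∀ p, (w p).1 = v ↔ p = l ∨ p = r) :
    (List.ofFn fun p => siteMat Q R Ψ (w p) v).prod 0 0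
      = (if (w l).2 = 0 then 1 else 0)
        * (if (w r).2 = 0 then 0 else if (w r).2 = 1 then 1 else Ψ v)
        * ∏ p, if l < p ∧ p < r then siteEntry Q R (w p) v else 1 := by
  have hl : (w l).1 = v := (hv l).2 (Or.inl rfl)
  have hr : (w r).1 = v := (hv r).2 (Or.inr rfl)
  have h := (prod_apply_pair (fun p => siteMat Q R Ψ (w p) v) (fun p => siteEntry Q R (w p) v)
    l.val r.val hlr (siteMat Q R Ψ (w l) v) (siteMat Q R Ψ (w r) v)
    (fun p h1 h2 => siteMat_of_ne Q R Ψ fun h => by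
      rcases (hv p).1 h.symm with rfl | rfl
      · exact h1 rfl
      · exact h2 rfl)
    (fun p h => by rw [Fin.ext h]) (fun p h => by rw [Fin.ext h])
    (by rw [← hl]; exact siteMat_self_diag Q R Ψ _ _)
    (by rw [← hr]; exact siteMat_self_diag Q R Ψ _ _)).1
  rw [h, if_pos r.2]
  have e1 : siteMat Q R Ψ (w l) v 0 1 = if (w l).2 = 0 then 1 else 0 := by
    rw [← hl]; exact siteMat_self_zero_one Q R Ψ _
  have e2 : siteMat Q R Ψ (w r) v 1 0
      = if (w r).2 = 0 then 0 else if (w r).2 = 1 then 1 else Ψ v := by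
    rw [← hr]; exact siteMat_self_one_zero Q R Ψ _
  rw [e1, e2]
  simp only [Fin.lt_def]

theorem even_card_fiber {w : Fin k → Fin N × Fin 3} (hw : wordWeight Q R Ψ w ≠ 0) (v : Fin N) :
    Even #{p | (w p).1 = v} := by
  by_contra h
  rw [Nat.not_even_iff_odd] at h
  apply hw
  rw [wordWeight]
  refine prod_eq_zero (mem_univ v) (prod_apply_of_odd _ {p | (w p).1 = v} ?_ ?_ h)
  · intro p hp
    simp only [mem_filter, mem_univ, true_and] at hp
    subst hp
    exact ⟨siteMat_self_diag Q R Ψ _ _, siteMat_self_diag Q R Ψ _ _⟩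
  · intro p hp
    simp only [mem_filter, mem_univ, true_and] at hp
    rw [siteMat_of_ne Q R Ψ (Ne.symm hp)]
    simp [sigma]

/-- The square is needed for the products `Q Q̃` in `T'`. -/
theorem abs_siteMat_le {B : ℝ} (hB : 1 ≤ B) (hQ : ∀ i j, i ≠ j → |Q i j| ≤ B)
    (hR : ∀ i j, i ≠ j → |R i j| ≤ B) (hΨ : ∀ i, |Ψ i| ≤ B) (x : Fin N × Fin 3) (v : Fin N)
    (i j : Fin 2) : |siteMat Q R Ψ x v i j| ≤ B ^ 2 := by
  have hB2 : B ≤ B ^ 2 := by nlinarith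
  have hz : |(0 : ℝ)| ≤ B ^ 2 := by rw [abs_zero]; positivity
  have ho : |(1 : ℝ)| ≤ B ^ 2 := by rw [abs_one]; exact hB.trans hB2
  by_cases h : v = x.1
  · subst h
    fin_cases i <;> fin_cases j
    · simpa only [Fin.zero_eta, siteMat_self_diag] using hz
    · simp only [Fin.zero_eta, Fin.mk_one, siteMat_self_zero_one]
      split_ifs
      · exact ho
      · exact hz
    · simp only [Fin.zero_eta, Fin.mk_one, siteMat_self_one_zero]
      split_ifs
      · exact hz
      · exact ho
      · exact (hΨ _).trans hB2
    · simpa only [Fin.mk_one, siteMat_self_diag] using hz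
  · have hv : (v : ℕ) ≠ x.1 := fun h' => h (Fin.ext h')
    have : |siteEntry Q R x v| ≤ B ^ 2 := by
      rw [siteEntry]
      split_ifs
      · exact (hR _ _ hv).trans hB2
      · rw [abs_mul, sq]
        exact mul_le_mul (hQ _ _ hv) (hR _ _ hv) (abs_nonneg _) (by linarith)
      · exact (hQ _ _ hv).trans hB2
      · exact ho
    rw [siteMat_of_ne Q R Ψ h]
    fin_cases i <;> fin_cases j
    · exact ho
    · exact hz
    · exact hz
    · exact this

/-- At most `k` sites are visited and every other site contributes `1`, so the bound does not depend
on `N`. -/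
theorem abs_wordWeight_le {B : ℝ} (hB : 1 ≤ B) (hQ : ∀ i j, i ≠ j → |Q i j| ≤ B)
    (hR : ∀ i j, i ≠ j → |R i j| ≤ B) (hΨ : ∀ i, |Ψ i| ≤ B) (w : Fin k → Fin N × Fin 3) :
    |wordWeight Q R Ψ w| ≤ ((2 * B ^ 2) ^ k) ^ k := by
  have hB2 : 1 ≤ B ^ 2 := one_le_pow₀ hB
  have hC : 1 ≤ (2 * B ^ 2) ^ k := one_le_pow₀ (by linarith)
  rw [wordWeight, abs_prod]
  calc _ ≤ ∏ v, if v ∈ univ.image (fun p => (w p).1) then (2 * B ^ 2) ^ k else 1 := by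
        refine prod_le_prod (fun _ _ => abs_nonneg _) fun v _ => ?_
        split_ifs with h
        · exact abs_prod_apply_le _ _ hB2
            (fun p i j => abs_siteMat_le Q R Ψ hB hQ hR hΨ (w p) v i j) _ _
        · rw [wordWeight_site_eq_one Q R Ψ fun p hp => h (mem_image.2 ⟨p, mem_univ _, hp⟩), abs_one]
    _ = ((2 * B ^ 2) ^ k) ^ #(univ.image fun p => (w p).1) := by
        rw [prod_ite_mem, univ_inter, prod_const]
    _ ≤ _ := pow_le_pow_right₀ hC (card_image_le.trans (by simp))

/-- The word attached to a pair partition of type B and an assignment of sites to its blocks. -/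
def pairWord (π : PairPartitionB k) (g : π.1.1.parts → Fin N) (p : Fin k) : Fin N × Fin 3 :=
  (g (blk π.1 p), if p = lo π.1 (blk π.1 p) then 0 else if π.2 (blk π.1 p) = -1 then 2 else 1)

variable (π : PairPartitionB k)

theorem pairWord_lo (g : π.1.1.parts → Fin N) (V : π.1.1.parts) :
    pairWord π g (lo π.1 V) = (g V, 0) := by simp [pairWord]

theorem pairWord_hi (g : π.1.1.parts → Fin N) (V : π.1.1.parts) :
    pairWord π g (hi π.1 V) = (g V, if π.2 V = -1 then 2 else 1) := by
  simp [pairWord, (lo_lt_hi V).ne']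

theorem prod_points {M : Type*} [CommMonoid M] (π : PairPartition k) (F : Fin k → M) :
    ∏ p, F p = ∏ W, (F (lo π W) * F (hi π W)) := by
  rw [← prod_fiberwise univ (blk π)]
  refine prod_congr rfl fun W _ => ?_
  have : univ.filter (fun p => blk π p = W) = {lo π W, hi π W} := by
    ext p
    simp [blk_eq_iff_lo_or_hi]
  rw [this, prod_pair (lo_lt_hi W).ne]

/-- The site of `V` collects a diagonal entry from every end point of another block strictly between
the end points of `V`; the strict inequalities make the factors with `W = V` trivial. -/
theorem wordWeight_pairWord (g : π.1.1.parts ↪ Fin N) :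
    wordWeight Q R Ψ (pairWord π g) = (∏ V, if π.2 V = -1 then Ψ (g V) else 1) *
      ∏ V, ∏ W,
        ((if lo π.1 V < lo π.1 W ∧ lo π.1 W < hi π.1 V then siteEntry Q R (g W, 0) (g V) else 1)
        * (if lo π.1 V < hi π.1 W ∧ hi π.1 W < hi π.1 V then
          siteEntry Q R (g W, if π.2 W = -1 then 2 else 1) (g V) else 1)) := by
  rw [wordWeight, ← prod_mul_distrib]
  have h1 : ∀ v, v ∉ univ.image g →
      (List.ofFn fun p => siteMat Q R Ψ (pairWord π g p) v).prod 0 0 = 1 := fun v hv =>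
    wordWeight_site_eq_one Q R Ψ fun p hp => hv (mem_image.2 ⟨blk π.1 p, mem_univ _, hp⟩)
  rw [← prod_subset (subset_univ (univ.image g)) fun v _ hv => h1 v hv,
    prod_image fun _ _ _ _ h => g.injective h]
  refine prod_congr rfl fun V _ => ?_
  rw [wordWeight_site_pair Q R Ψ (lo_lt_hi V) fun p => ?_]
  · rw [pairWord_lo, pairWord_hi, prod_points π.1]
    simp only [pairWord_lo, pairWord_hi, if_true, one_mul]
    congr 1
    split_ifs <;> simp_all
  · rw [← blk_eq_iff_lo_or_hi, pairWord]
    exact g.injective.eq_iff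

/-- The fibres of the site map recover `π`, the sites recover `g`, and the letters at the right end
points recover the colours. -/
theorem pairWord_injective : Function.Injective
    (fun x : Σ π : PairPartitionB k, (π.1.1.parts ↪ Fin N) => pairWord x.1 x.2) := by
  rintro ⟨⟨π, f⟩, g⟩ ⟨⟨ρ, f'⟩, g'⟩ h
  simp only at h
  have hπ : π = ρ := by
    refine PairPartition.ext_of_part fun p => ?_
    have key : ∀ (τ : PairPartition k) (f : τ.1.parts → ℤˣ) (g : τ.1.parts ↪ Fin N) (x : Fin k),
        x ∈ τ.1.part p ↔ (pairWord ⟨τ, f⟩ g x).1 = (pairWord ⟨τ, f⟩ g p).1 := by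
      intro τ f g x
      change x ∈ (blk τ p : Finset (Fin k)) ↔ _
      rw [← blk_eq_iff]
      exact g.injective.eq_iff.symm
    ext x
    rw [key π f g, key ρ f' g', h]
  subst hπ
  have hg : g = g' := by
    ext V
    have := congrFun h (lo π V)
    rw [pairWord_lo ⟨π, f⟩, pairWord_lo ⟨π, f'⟩] at this
    exact congrArg Fin.val (congrArg Prod.fst this)
  have hf : f = f' := by
    funext V
    have := congrArg Prod.snd (congrFun h (hi π V))
    rw [pairWord_hi ⟨π, f⟩, pairWord_hi ⟨π, f'⟩] at this
    simp only at this
    rcases Int.units_eq_one_or (f V) with h1 | h1 <;>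
      rcases Int.units_eq_one_or (f' V) with h2 | h2 <;> simp_all
  subst hg hf
  rfl

/-- Nonempty fibres of even size have at least two elements; with at least `k/2` fibres over `k`
positions, all have exactly two. -/
theorem exists_pairWord_eq {w : Fin k → Fin N × Fin 3} (hw : wordWeight Q R Ψ w ≠ 0)
    (hk : k ≤ 2 * #(univ.image fun p => (w p).1)) :
    ∃ (π : PairPartitionB k) (g : π.1.1.parts ↪ Fin N), pairWord π g = w := by
  have hcard : ∀ p, #{p' | (w p').1 = (w p).1} = 2 := by
    have hge : ∀ v ∈ univ.image (fun p => (w p).1), 2 ≤ #{p' | (w p').1 = v} := by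
      intro v hv
      obtain ⟨p, -, rfl⟩ := mem_image.1 hv
      have h0 : 0 < #{p' | (w p').1 = (w p).1} := card_pos.2 ⟨p, by simp⟩
      have := even_card_fiber Q R Ψ hw (w p).1
      obtain ⟨c, hc⟩ := this
      omega
    have hsum : ∑ v ∈ univ.image (fun p => (w p).1), #{p' | (w p').1 = v} = k := by
      rw [← card_eq_sum_card_image, card_univ, Fintype.card_fin]
    have hsum2 : ∑ v ∈ univ.image (fun p => (w p).1), 2
        = ∑ v ∈ univ.image (fun p => (w p).1), #{p' | (w p').1 = v} := by
      apply le_antisymm (sum_le_sum hge)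
      rw [hsum, sum_const, smul_eq_mul]
      omega
    intro p
    exact ((sum_eq_sum_iff_of_le hge).1 hsum2 _ (mem_image_of_mem _ (mem_univ p))).symm
  obtain ⟨π, hπ⟩ := exists_pairPartition_of_equivalence (Setoid.ker fun p => (w p).1) fun p => by
    have h := hcard p
    rw [card_eq_two] at h
    obtain ⟨a, b, hab, h⟩ := h
    have hx : ∀ x, (w p).1 = (w x).1 ↔ x = a ∨ x = b := fun x => by
      rw [← mem_singleton (a := b), ← mem_insert, ← h]
      simp [eq_comm]
    rcases (hx p).1 rfl with rfl | rfl
    · exact ⟨b, hab.symm, hx⟩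
    · exact ⟨a, hab, fun x => (hx x).trans or_comm⟩
  have hrel : ∀ p x, blk π p = blk π x ↔ (w p).1 = (w x).1 := by
    intro p x
    rw [eq_comm, blk_eq_iff]
    exact hπ p x
  have hsame : ∀ p, (w (lo π (blk π p))).1 = (w p).1 := fun p => (hrel _ _).1 (by simp)
  let f : π.1.parts → ℤˣ := fun V => if (w (hi π V)).2 = 2 then -1 else 1
  let g : π.1.parts ↪ Fin N := ⟨fun V => (w (lo π V)).1, fun V W h => by
    have := (hrel _ _).2 h
    simpa using this⟩
  have hloc : ∀ V : π.1.parts, (w (lo π V)).2 = 0 ∧ (w (hi π V)).2 ≠ 0 := by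
    intro V
    have h1 := prod_ne_zero_iff.1 hw (g V) (mem_univ _)
    rw [wordWeight_site_pair Q R Ψ (lo_lt_hi V) fun p => ?_] at h1
    · constructor
      · by_contra h
        simp [h] at h1
      · intro h
        simp [h] at h1
    · rw [← blk_eq_iff_lo_or_hi, ← blk_lo V, hrel, blk_lo]
      rfl
  refine ⟨⟨π, f⟩, g, funext fun p => ?_⟩
  have hcases : ∀ c : Fin 3, c ≠ 0 → c ≠ 2 → c = 1 := by decide
  rcases eq_lo_or_hi_blk (π := π) p with hp | hp
  · rw [hp, pairWord_lo ⟨π, f⟩]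
    exact Prod.ext rfl (hloc _).1.symm
  · rw [hp, pairWord_hi ⟨π, f⟩]
    refine Prod.ext ?_ ?_
    · change (w (lo π (blk π p))).1 = _
      rw [hsame, ← hp]
    · simp only [f]
      have h2 := (hloc (blk π p)).2
      by_cases h : (w (hi π (blk π p))).2 = 2
      · simp [h]
      · simp [hcases _ h2 h]

theorem abs_sum_words_sub_le :
    |∑ w : Fin k → Fin N × Fin 3, wordWeight Q R Ψ w
        - ∑ π : PairPartitionB k, ∑ g : π.1.1.parts ↪ Fin N, wordWeight Q R Ψ (pairWord π g)|
      ≤ ∑ w : Fin k → Fin N × Fin 3 with 2 * #(univ.image fun p => (w p).1) < k,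
        |wordWeight Q R Ψ w| := by
  classical
  rw [← Fintype.sum_sigma'
    (fun (π : PairPartitionB k) (g : π.1.1.parts ↪ Fin N) => wordWeight Q R Ψ (pairWord π g)),
    ← sum_image (f := wordWeight Q R Ψ)
      (g := fun x : Σ π : PairPartitionB k, (π.1.1.parts ↪ Fin N) => pairWord x.1 x.2)
      (fun _ _ _ _ h => pairWord_injective h),
    ← sum_sdiff (subset_univ _), add_sub_cancel_right]
  refine (abs_sum_le_sum_abs _ _).trans ?_
  rw [← sum_filter_ne_zero]
  refine sum_le_sum_of_subset_of_nonneg (fun w hw => ?_) fun _ _ _ => abs_nonneg _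
  obtain ⟨hw, h0⟩ := mem_filter.1 hw
  simp only [mem_filter, mem_univ, true_and]
  by_contra h
  obtain ⟨π, g, rfl⟩ := exists_pairWord_eq Q R Ψ (abs_ne_zero.1 h0) (not_lt.1 h)
  exact (mem_sdiff.1 hw).2 (mem_image.2 ⟨⟨π, g⟩, mem_univ _, rfl⟩)

end PairWords

/-! ### Counting words that visit few sites -/

section Counting

/-- Such a map factors through `Fin n`, and the pairs of factors are counted instead. -/
theorem card_filter_card_image_le {ι β : Type*} [Fintype ι] [DecidableEq ι] [Fintype β]
    [DecidableEq β] [Nonempty β] (n : ℕ) :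
    #{s : ι → β | #(univ.image s) ≤ n} ≤ n ^ Fintype.card ι * Fintype.card β ^ n := by
  have hsub : univ.filter (fun s : ι → β => #(univ.image s) ≤ n)
      ⊆ univ.image (fun x : (ι → Fin n) × (Fin n → β) => x.2 ∘ x.1) := by
    intro s hs
    simp only [mem_filter, mem_univ, true_and] at hs
    obtain ⟨a⟩ : Nonempty (univ.image s ↪ Fin n) := by
      rw [Function.Embedding.nonempty_iff_card_le, Fintype.card_coe, Fintype.card_fin]; exact hs
    refine mem_image.2 ⟨(fun i => a ⟨s i, mem_image_of_mem s (mem_univ i)⟩,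
      fun j => if h : ∃ b, a b = j then h.choose.1 else Classical.arbitrary β), mem_univ _, ?_⟩
    funext i
    have h : ∃ b, a b = a ⟨s i, mem_image_of_mem s (mem_univ i)⟩ := ⟨_, rfl⟩
    simp only [Function.comp_apply, dif_pos h]
    rw [a.injective h.choose_spec]
  calc _ ≤ _ := card_le_card hsub
    _ ≤ _ := card_image_le
    _ = _ := by simp

theorem card_words_le {N k : ℕ} [NeZero N] (n : ℕ) :
    #{w : Fin k → Fin N × Fin 3 | #(univ.image fun p => (w p).1) ≤ n}
      ≤ n ^ k * N ^ n * 3 ^ k := by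
  have h := card_filter_card_image_le (ι := Fin k) (β := Fin N) n
  simp only [Fintype.card_fin] at h
  calc _ ≤ #((univ.filter fun s : Fin k → Fin N => #(univ.image s) ≤ n)
          ×ˢ (univ : Finset (Fin k → Fin 3))) := by
        refine card_le_card_of_injOn (fun w => (fun p => (w p).1, fun p => (w p).2)) ?_ ?_
        · intro w hw
          simpa using hw
        · intro w _ w' _ h
          simp only [Prod.mk.injEq] at h
          funext p
          exact Prod.ext (congrFun h.1 p) (congrFun h.2 p)
    _ ≤ _ := by
        rw [card_product]
        exact Nat.mul_le_mul h (by simp)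

end Counting

end TypeB

namespace TypeB

open Finset

/-! ### The random factors attached to pairs of blocks, and their means -/

section Interactions

variable {N k : ℕ}

/-- The exponent of `Q̃(gV, gW)` in the weight of a word. -/
def expR (π : PairPartitionB k) (V W : π.1.1.parts) : ℕ :=
  if π.2 W = -1 ∧ lo π.1 V < hi π.1 W ∧ hi π.1 W < hi π.1 V then 1 else 0

/-- The exponent of `Q(gV, gW)` in the weight of a word, if `gV < gW`. -/
def expQ (π : PairPartitionB k) (V W : π.1.1.parts) : ℕ :=
  (if lo π.1 V < lo π.1 W ∧ lo π.1 W < hi π.1 V then 1 else 0)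
    + (if π.2 W ≠ -1 ∧ lo π.1 V < hi π.1 W ∧ hi π.1 W < hi π.1 V then 1 else 0)
    + expR π W V

variable (π : PairPartitionB k)

theorem expR_self (V : π.1.1.parts) : expR π V V = 0 := by simp [expR]

theorem expR_le (V W : π.1.1.parts) : expR π V W ≤ 1 := by
  rw [expR]; split_ifs <;> simp

theorem expQ_le (V W : π.1.1.parts) : expQ π V W ≤ 3 := by
  have := expR_le π W V
  rw [expQ]; split_ifs <;> omega

/-- The product of the random entries that occur in the weight of a word. -/
noncomputable def interaction (Q R : ℕ → ℕ → ℝ) (g : π.1.1.parts ↪ Fin N) : ℝ :=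
  ∏ V, ∏ W, ((if g V < g W then Q (g V) (g W) ^ expQ π V W else 1)
    * R (g V) (g W) ^ expR π V W)

/-- Collects all powers of the same variable, so that distinct factors are independent. The factor
`Q` in the tail of a letter `T'` is attached to its pair of sites in increasing order; it is the
source of the last term of `expQ`. -/
theorem prod_siteEntry_eq_interaction (Q R : ℕ → ℕ → ℝ) (hQ : ∀ i j, j < i → Q i j = Q j i)
    (g : π.1.1.parts ↪ Fin N) :
    ∏ V, ∏ W,
        ((if lo π.1 V < lo π.1 W ∧ lo π.1 W < hi π.1 V then siteEntry Q R (g W, 0) (g V) else 1)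
        * (if lo π.1 V < hi π.1 W ∧ hi π.1 W < hi π.1 V then
          siteEntry Q R (g W, if π.2 W = -1 then 2 else 1) (g V) else 1))
      = interaction π Q R g := by
  have h1 : ∀ V W : π.1.1.parts,
      ((if lo π.1 V < lo π.1 W ∧ lo π.1 W < hi π.1 V then siteEntry Q R (g W, 0) (g V) else 1)
        * (if lo π.1 V < hi π.1 W ∧ hi π.1 W < hi π.1 V then
          siteEntry Q R (g W, if π.2 W = -1 then 2 else 1) (g V) else 1))
      = ((if g V < g W then Q (g V) (g W) ^ (expQ π V W - expR π W V) else 1)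
          * R (g V) (g W) ^ expR π V W)
        * (if g W < g V then Q (g W) (g V) ^ expR π V W else 1) := by
    intro V W
    by_cases hVW : V = W
    · subst hVW
      simp [expR_self]
    · rcases lt_or_gt_of_ne (fun h => hVW (g.injective h)) with h | h
      · have h' : ¬ g W < g V := h.not_gt
        simp only [expQ, expR, add_tsub_cancel_right, siteEntry, h, h', if_true, if_false]
        by_cases c1 : lo π.1 V < lo π.1 W ∧ lo π.1 W < hi π.1 V <;>
        by_cases c2 : lo π.1 V < hi π.1 W ∧ hi π.1 W < hi π.1 V <;>
        by_cases c3 : π.2 W = -1 <;> simp [c1, c2, c3]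
        all_goals ring
      · have h' : ¬ g V < g W := h.not_gt
        have hsymm := hQ (g V) (g W) h
        simp only [expR, siteEntry, h, h', if_true, if_false, hsymm]
        by_cases c2 : lo π.1 V < hi π.1 W ∧ hi π.1 W < hi π.1 V <;>
        by_cases c3 : π.2 W = -1 <;> simp [c2, c3]
        all_goals ring
  simp_rw [h1, prod_mul_distrib]
  -- Exchanging `V` and `W` brings the stray powers of `Q` to the case `g V < g W`.
  rw [prod_comm (f := fun V W => if g W < g V then Q (g W) (g V) ^ expR π V W else 1),
    interaction]
  simp_rw [prod_mul_distrib]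
  rw [mul_right_comm]
  congr 1
  rw [← prod_mul_distrib]
  refine prod_congr rfl fun V _ => ?_
  rw [← prod_mul_distrib]
  refine prod_congr rfl fun W _ => ?_
  split_ifs
  · rw [← pow_add]
    congr 1
    simp [expQ]
  · simp

theorem prod_prod_eq_prod_ordered {ι κ M : Type*} [Fintype ι] [LinearOrder κ] [CommMonoid M]
    {o : ι → κ} (ho : Function.Injective o) (F : ι → ι → M) (hF : ∀ V, F V V = 1) :
    ∏ V, ∏ W, F V W = ∏ V, ∏ W, if o V < o W then F V W * F W V else 1 := by
  have h1 : ∀ V W, F V W = (if o V < o W then F V W else 1) * (if o W < o V then F V W else 1) := by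
    intro V W
    rcases lt_trichotomy (o V) (o W) with h | h | h
    · simp [h, h.not_gt]
    · rw [← ho h]; simp [hF]
    · simp [h, h.not_gt]
  rw [prod_congr rfl fun V _ => prod_congr rfl fun W _ => h1 V W]
  simp_rw [prod_mul_distrib]
  rw [prod_comm (f := fun V W => if o W < o V then F V W else 1), ← prod_mul_distrib]
  refine prod_congr rfl fun V _ => ?_
  rw [← prod_mul_distrib]
  refine prod_congr rfl fun W _ => ?_
  split_ifs <;> simp

theorem pow_Cr_add_Nest (q : ℝ) :
    q ^ (Cr π.1 + 2 * Nest π) = ∏ V : π.1.1.parts, ∏ W : π.1.1.parts,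
      ((if Crosses (V : Finset (Fin k)) (W : Finset (Fin k)) then q else 1)
        * (if π.2 W = -1 ∧ Nests (V : Finset (Fin k)) (W : Finset (Fin k)) then q ^ 2 else 1)) := by
  have hN : Nest π = ∑ V : π.1.1.parts,
      #{W : π.1.1.parts | π.2 W = -1 ∧ Nests (V : Finset (Fin k)) (W : Finset (Fin k))} := by
    rw [Nest]
    convert natCard_pairs (fun V W : π.1.1.parts =>
      π.2 W = -1 ∧ Nests (V : Finset (Fin k)) (W : Finset (Fin k)))
  rw [pow_add, pow_mul, Cr_eq_sum, hN, ← prod_pow_eq_pow_sum, ← prod_pow_eq_pow_sum]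
  simp_rw [prod_mul_distrib]
  congr 1 <;> refine prod_congr rfl fun V _ => ?_ <;> rw [← prod_filter, prod_const]

/-- Here `μ` and `ν` are the moments of `Q` and `Q̃`. Take `V` to open before `W`. If they cross,
the variables are `Q` for `f V = 1`, and `Q² Q̃` or `Q̃` for `f V = -1`: mean `q`. If `V` nests `W`,
they are `Q²` or `1` for `f W = 1`, with mean `1`, and `Q Q̃` for `f W = -1`, with mean `q²`.
Disjoint blocks do not interact. So the order of the sites is irrelevant. -/
theorem prod_means_eq (q : ℝ) (μ ν : ℕ → ℝ) (hμ0 : μ 0 = 1) (hμ1 : μ 1 = q) (hμ2 : μ 2 = 1)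
    (hν0 : ν 0 = 1) (hν1 : ν 1 = q) (g : π.1.1.parts ↪ Fin N) :
    ∏ V, ∏ W, ((if g V < g W then μ (expQ π V W) else 1) * ν (expR π V W))
      = q ^ (Cr π.1 + 2 * Nest π) := by
  rw [pow_Cr_add_Nest, prod_prod_eq_prod_ordered lo_injective, prod_prod_eq_prod_ordered
    (F := fun V W : π.1.1.parts =>
      (if Crosses (V : Finset (Fin k)) (W : Finset (Fin k)) then q else 1)
        * (if π.2 W = -1 ∧ Nests (V : Finset (Fin k)) (W : Finset (Fin k)) then q ^ 2 else 1))
      lo_injective]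
  · refine prod_congr rfl fun V _ => prod_congr rfl fun W _ => ?_
    by_cases h : lo π.1 V < lo π.1 W
    · rw [if_pos h, if_pos h]
      have hVW : V ≠ W := by rintro rfl; exact lt_irrefl _ h
      have hne : g V ≠ g W := fun h => hVW (g.injective h)
      have hV := lo_lt_hi V
      have hW := lo_lt_hi W
      have hh : hi π.1 V ≠ hi π.1 W := fun h => hVW (hi_injective h)
      have hlh := lo_ne_hi W V
      simp only [crosses_iff, nests_iff, expQ, expR]
      have e1 : ¬ lo π.1 W < lo π.1 V := h.not_gt
      rcases lt_or_gt_of_ne hlh with c1 | c1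
      · have e2 : lo π.1 V < hi π.1 W := h.trans hW
        rcases lt_or_gt_of_ne hh with c2 | c2
        · rcases lt_or_gt_of_ne hne with c3 | c3 <;>
          by_cases c4 : π.2 V = -1 <;>
          simp [h, c1, c2, c3, c4, e1, c2.not_gt, c3.not_gt, hμ0, hμ1, hμ2, hν0, hν1]
        · rcases lt_or_gt_of_ne hne with c3 | c3 <;>
          by_cases c4 : π.2 W = -1 <;>
          simp [h, c1, c2, c3, c4, e1, e2, c2.not_gt, c3.not_gt, hμ0, hμ1, hμ2, hν0, hν1, sq]
      · have e2 : ¬ hi π.1 W < hi π.1 V := (c1.trans hW).not_gt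
        rcases lt_or_gt_of_ne hne with c3 | c3 <;>
          simp [h, c3, e1, e2, c1.not_gt, c3.not_gt, hμ0, hν0]
    · rw [if_neg h, if_neg h]
  · intro V; simp [crosses_iff, nests_iff]
  · intro V; simp [expR_self, hν0]

end Interactions

end TypeB

namespace TypeB

open Finset

open MeasureTheory ProbabilityTheory Filter Topology

/-! ### Almost sure convergence from second moments -/

section General

variable {Ω : Type*} [MeasurableSpace Ω] {P : Measure Ω}

/-- The series of the `Y_n²` has finite integral, so it converges almost everywhere and its terms
tend to `0`. -/
theorem ae_tendsto_zero_of_summable_integral_sq {Y : ℕ → Ω → ℝ}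
    (hint : ∀ n, Integrable (fun ω => Y n ω ^ 2) P)
    (hsum : Summable fun n => ∫ ω, Y n ω ^ 2 ∂P) :
    ∀ᵐ ω ∂P, Tendsto (fun n => Y n ω) atTop (𝓝 0) := by
  have hmeas : ∀ n, AEMeasurable (fun ω => ENNReal.ofReal (Y n ω ^ 2)) P := fun n =>
    (hint n).aestronglyMeasurable.aemeasurable.ennreal_ofReal
  have hfin : ∫⁻ ω, ∑' n, ENNReal.ofReal (Y n ω ^ 2) ∂P ≠ ⊤ := by
    rw [lintegral_tsum hmeas]
    simp_rw [← fun n => ofReal_integral_eq_lintegral_ofReal (hint n)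
      (ae_of_all _ fun ω => sq_nonneg (Y n ω))]
    exact hsum.tsum_ofReal_ne_top
  filter_upwards [ae_lt_top' (AEMeasurable.tsum hmeas) hfin] with ω hω
  have h1 := ENNReal.tendsto_atTop_zero_of_tsum_ne_top hω.ne
  have h2 : Tendsto (fun n => Y n ω ^ 2) atTop (𝓝 0) := by
    have h3 := (ENNReal.tendsto_toReal ENNReal.zero_ne_top).comp h1
    refine h3.congr fun n => ?_
    simp [ENNReal.toReal_ofReal (sq_nonneg _)]
  have h3 := (Real.continuous_sqrt.tendsto 0).comp h2
  rw [Real.sqrt_zero] at h3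
  rw [tendsto_zero_iff_abs_tendsto_zero]
  exact h3.congr fun n => Real.sqrt_sq_eq_abs _

/-- Only the bad pairs have a nonzero covariance, and each covariance is at most `C²` since
subtracting `m²` only helps. -/
theorem integral_sum_sub_sq_le [IsProbabilityMeasure P] {G : Type*} [Fintype G] [DecidableEq G]
    {f : G → Ω → ℝ} {C m : ℝ} (hC : 0 ≤ C) (hmeas : ∀ g, AEStronglyMeasurable (f g) P)
    (hbd : ∀ᵐ ω ∂P, ∀ g, |f g ω| ≤ C) (hm : ∀ g, ∫ ω, f g ω ∂P = m) (bad : Finset (G × G))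
    (hgood : ∀ x, x ∉ bad → ∫ ω, f x.1 ω * f x.2 ω ∂P = m * m) :
    Integrable (fun ω => (∑ g, (f g ω - m)) ^ 2) P ∧
    ∫ ω, (∑ g, (f g ω - m)) ^ 2 ∂P ≤ #bad * C ^ 2 := by
  have hi : ∀ g, Integrable (f g) P := fun g =>
    Integrable.of_bound (hmeas g) C (hbd.mono fun ω h => h g)
  have hbd2 : ∀ g g', ∀ᵐ ω ∂P, ‖f g ω * f g' ω‖ ≤ C ^ 2 := fun g g' => hbd.mono fun ω h => by
    rw [norm_mul, sq]
    exact mul_le_mul (h g) (h g') (abs_nonneg _) hC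
  have hi2 : ∀ g g', Integrable (fun ω => f g ω * f g' ω) P := fun g g' =>
    Integrable.of_bound ((hmeas g).mul (hmeas g')) (C ^ 2) (hbd2 g g')
  have hexp : ∀ g g' ω, (f g ω - m) * (f g' ω - m)
      = f g ω * f g' ω - m * f g ω - m * f g' ω + m * m := fun _ _ _ => by ring
  have i1 : ∀ g g', Integrable (fun ω => f g ω * f g' ω - m * f g ω) P := fun g g' =>
    (hi2 g g').sub ((hi g).const_mul m)
  have i2 : ∀ g g', Integrable (fun ω => f g ω * f g' ω - m * f g ω - m * f g' ω) P := fun g g' =>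
    (i1 g g').sub ((hi g').const_mul m)
  have hi3 : ∀ g g', Integrable (fun ω => (f g ω - m) * (f g' ω - m)) P := fun g g' => by
    simp_rw [hexp]
    exact (i2 g g').add (integrable_const _)
  have hcov : ∀ g g', ∫ ω, (f g ω - m) * (f g' ω - m) ∂P = ∫ ω, f g ω * f g' ω ∂P - m * m := by
    intro g g'
    simp_rw [hexp]
    rw [integral_add (i2 g g') (integrable_const _), integral_sub (i1 g g') ((hi g').const_mul m),
      integral_sub (hi2 g g') ((hi g).const_mul m), integral_const_mul, integral_const_mul, hm, hm]
    simp
  have hsq : ∀ ω, (∑ g, (f g ω - m)) ^ 2 = ∑ x : G × G, (f x.1 ω - m) * (f x.2 ω - m) := by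
    intro ω
    rw [sq, sum_mul_sum, Fintype.sum_prod_type]
  simp_rw [hsq]
  refine ⟨integrable_finsetSum _ fun x _ => hi3 _ _, ?_⟩
  rw [integral_finsetSum _ fun x _ => hi3 _ _]
  simp_rw [hcov]
  rw [← sum_subset (subset_univ bad) fun x _ hx => by rw [hgood x hx, sub_self]]
  calc _ ≤ ∑ x ∈ bad, C ^ 2 := by
        refine sum_le_sum fun x _ => ?_
        have h1 : ∫ ω, f x.1 ω * f x.2 ω ∂P ≤ C ^ 2 := by
          have := norm_integral_le_of_norm_le_const (hbd2 x.1 x.2)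
          simp only [Real.norm_eq_abs, probReal_univ, mul_one] at this
          exact (le_abs_self _).trans this
        nlinarith [mul_self_nonneg m]
    _ = _ := by rw [sum_const, nsmul_eq_mul]

/-- Asymptotically all maps from the `n` blocks to the sites are injective. -/
theorem tendsto_descFactorial_div_pow (n : ℕ) :
    Tendsto (fun N : ℕ => ((N : ℝ) ^ n)⁻¹ * N.descFactorial n) atTop (𝓝 1) := by
  have h1 : Tendsto (fun N : ℕ => (1 - (n : ℝ) / N) ^ n) atTop (𝓝 1) := by
    have h := (tendsto_const_nhds (x := (1 : ℝ))).sub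
      (tendsto_const_div_atTop_nhds_zero_nat (n : ℝ))
    simpa using h.pow n
  refine tendsto_of_tendsto_of_tendsto_of_le_of_le' h1 tendsto_const_nhds ?_ ?_
  · filter_upwards [eventually_ge_atTop (n + 1)] with N hN
    have hN0 : (0 : ℝ) < N := by exact_mod_cast (by omega : 0 < N)
    have h : (N - n) ^ n ≤ N.descFactorial n :=
      (Nat.pow_le_pow_left (by omega) n).trans (Nat.pow_sub_le_descFactorial N n)
    have h2 : ((N - n : ℕ) : ℝ) ^ n ≤ N.descFactorial n := by exact_mod_cast h
    rw [Nat.cast_sub (by omega)] at h2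
    rw [inv_mul_eq_div, le_div_iff₀ (by positivity), ← mul_pow, sub_mul, one_mul,
      div_mul_cancel₀ _ hN0.ne']
    exact h2
  · filter_upwards [eventually_ge_atTop 1] with N hN
    have hN0 : (0 : ℝ) < N := by exact_mod_cast hN
    rw [inv_mul_le_iff₀ (by positivity), mul_one]
    exact_mod_cast Nat.descFactorial_le_pow N n

end General

/-! ### Law of large numbers for the interactions -/

section Entries

/-- The indices of the entries `Q(i,j)`, `i < j`, and `Q̃(i,j)`, `i ≠ j`. -/
abbrev EntryIdx : Type := {p : ℕ × ℕ // p.1 < p.2} ⊕ {p : ℕ × ℕ // p.1 ≠ p.2}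

/-- The family of the entries `Q(i,j)`, `i < j`, and `Q̃(i,j)`, `i ≠ j`. -/
def entry {Ω : Type*} (Q R : ℕ → ℕ → Ω → ℝ) : EntryIdx → Ω → ℝ :=
  Sum.elim (fun p => Q p.1.1 p.1.2) (fun p => R p.1.1 p.1.2)

/-- The indices of the factors of `interaction π Q R g`. -/
abbrev PairIdx {ι : Type*} {N : ℕ} (g : ι ↪ Fin N) : Type _ :=
  {p : ι × ι // g p.1 < g p.2} ⊕ {p : ι × ι // p.1 ≠ p.2}

/-- The entry that belongs to a factor of `interaction π Q R g`. -/
def toEntry {ι : Type*} {N : ℕ} (g : ι ↪ Fin N) : PairIdx g → EntryIdx :=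
  Sum.map (fun p => ⟨(g p.1.1, g p.1.2), p.2⟩)
    (fun p => ⟨(g p.1.1, g p.1.2), fun h => p.2 (g.injective (Fin.ext h))⟩)

/-- The exponents of the factors of `interaction π Q R g`. -/
def pairExp {k N : ℕ} (π : PairPartitionB k) (g : π.1.1.parts ↪ Fin N) : PairIdx g → ℕ :=
  Sum.elim (fun p => expQ π p.1.1 p.1.2) (fun p => expR π p.1.1 p.1.2)

theorem toEntry_injective {ι : Type*} {N : ℕ} (g : ι ↪ Fin N) :
    Function.Injective (toEntry g) := by
  refine Function.Injective.sumMap ?_ ?_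
  all_goals
    rintro ⟨⟨a, b⟩, h⟩ ⟨⟨a', b'⟩, h'⟩ e
    simp only [Subtype.mk.injEq, Prod.mk.injEq] at e ⊢
    exact ⟨g.injective (Fin.ext e.1), g.injective (Fin.ext e.2)⟩

theorem exists_common_pair {ι : Type*} {N : ℕ} {g g' : ι ↪ Fin N}
    (h : ¬ Function.Injective (Sum.elim (toEntry g) (toEntry g'))) :
    ∃ V W V' W', V ≠ W ∧ g V = g' V' ∧ g W = g' W' := by
  by_contra hcon
  push Not at hcon
  refine h ((toEntry_injective g).sumElim (toEntry_injective g') ?_)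
  rintro (⟨⟨a, b⟩, hab⟩ | ⟨⟨a, b⟩, hab⟩) (⟨⟨a', b'⟩, hab'⟩ | ⟨⟨a', b'⟩, hab'⟩) e
  · simp only [toEntry, Sum.map_inl, Sum.inl.injEq, Subtype.mk.injEq, Prod.mk.injEq] at e
    exact hcon a b a' b' (fun h => by subst h; exact lt_irrefl _ hab) (Fin.ext e.1) (Fin.ext e.2)
  · simp [toEntry] at e
  · simp [toEntry] at e
  · simp only [toEntry, Sum.map_inr, Sum.inr.injEq, Subtype.mk.injEq, Prod.mk.injEq] at e
    exact hcon a b a' b' hab (Fin.ext e.1) (Fin.ext e.2)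

/-- A shared entry forces two shared sites, so `g` and `g'` together use at most `2n - 2` sites. The
factor `N ^ 2` on the left keeps the exponents free of subtraction. -/
theorem card_not_injective_mul_le {ι : Type*} [Fintype ι] [DecidableEq ι] {N : ℕ} [NeZero N]
    (bad : Finset ((ι ↪ Fin N) × (ι ↪ Fin N)))
    (hbad : ∀ x ∈ bad, ¬ Function.Injective (Sum.elim (toEntry x.1) (toEntry x.2))) :
    #bad * N ^ 2 ≤ (2 * Fintype.card ι - 2) ^ (2 * Fintype.card ι) * N ^ (2 * Fintype.card ι) := by
  rcases bad.eq_empty_or_nonempty with rfl | ⟨x, hx⟩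
  · simp
  -- Ensures that `2n - 2` is not truncated.
  have hn : 2 ≤ Fintype.card ι := by
    obtain ⟨V, W, -, -, hVW, -⟩ := exists_common_pair (hbad x hx)
    exact Fintype.one_lt_card_iff.2 ⟨V, W, hVW⟩
  have hcount := card_filter_card_image_le (ι := ι ⊕ ι) (β := Fin N) (2 * Fintype.card ι - 2)
  rw [Fintype.card_sum, Fintype.card_fin, ← two_mul] at hcount
  have hle : #bad ≤ #{s : ι ⊕ ι → Fin N | #(univ.image s) ≤ 2 * Fintype.card ι - 2} := by
    refine card_le_card_of_injOn (fun x => Sum.elim x.1 x.2) ?_ ?_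
    · intro x hx
      obtain ⟨V, W, V', W', hVW, h1, h2⟩ := exists_common_pair (hbad x hx)
      simp only [coe_filter, mem_univ, true_and, Set.mem_ofPred_eq]
      have himg : univ.image (Sum.elim x.1 x.2) = univ.image x.1 ∪ univ.image x.2 := by
        ext v; simp
      have hc1 : #(univ.image x.1) = Fintype.card ι := card_image_of_injective _ x.1.injective
      have hc2 : #(univ.image x.2) = Fintype.card ι := card_image_of_injective _ x.2.injective
      have hsub : {x.1 V, x.1 W} ⊆ univ.image x.1 ∩ univ.image x.2 := by
        intro v hv
        rw [mem_insert, mem_singleton] at hv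
        rcases hv with rfl | rfl
        · exact mem_inter.2 ⟨mem_image_of_mem _ (mem_univ _), h1 ▸ mem_image_of_mem _ (mem_univ _)⟩
        · exact mem_inter.2 ⟨mem_image_of_mem _ (mem_univ _), h2 ▸ mem_image_of_mem _ (mem_univ _)⟩
      have hc3 := card_le_card hsub
      rw [card_pair fun h => hVW (x.1.injective h)] at hc3
      have := card_union_add_card_inter (univ.image x.1) (univ.image x.2)
      rw [himg]
      omega
    · intro x _ y _ h
      refine Prod.ext ?_ ?_
      · ext i; exact congrArg Fin.val (congrFun h (Sum.inl i))
      · ext i; exact congrArg Fin.val (congrFun h (Sum.inr i))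
  calc _ ≤ (2 * Fintype.card ι - 2) ^ (2 * Fintype.card ι) * N ^ (2 * Fintype.card ι - 2) * N ^ 2 :=
        Nat.mul_le_mul_right _ (hle.trans hcount)
    _ = _ := by
        rw [mul_assoc, ← pow_add]
        congr 2
        omega

theorem prod_prod_eq_prod_pairIdx {ι M : Type*} [Fintype ι] [DecidableEq ι] [CommMonoid M] {N : ℕ}
    (g : ι ↪ Fin N) (F G : ι → ι → M) (hG : ∀ V, G V V = 1) :
    ∏ V, ∏ W, ((if g V < g W then F V W else 1) * G V W)
      = ∏ x : PairIdx g, Sum.elim (fun p => F p.1.1 p.1.2) (fun p => G p.1.1 p.1.2) x := by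
  rw [Fintype.prod_sum_type]
  simp_rw [prod_mul_distrib]
  congr 1
  · rw [← Fintype.prod_prod_type', ← prod_filter,
      prod_subtype (p := fun p : ι × ι => g p.1 < g p.2) _ (by simp)]
    rfl
  · rw [← Fintype.prod_prod_type',
      ← prod_subset (subset_univ (univ.filter fun p : ι × ι => p.1 ≠ p.2)),
      prod_subtype (p := fun p : ι × ι => p.1 ≠ p.2) _ (by simp)]
    · rfl
    · rintro ⟨a, b⟩ _ h
      simp only [mem_filter, mem_univ, true_and, not_not] at h
      subst h
      exact hG a

theorem interaction_eq_prod_entry {Ω : Type*} {k N : ℕ} (π : PairPartitionB k)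
    (Q R : ℕ → ℕ → Ω → ℝ) (ω : Ω) (g : π.1.1.parts ↪ Fin N) :
    interaction π (fun i j => Q i j ω) (fun i j => R i j ω) g
      = ∏ x : PairIdx g, entry Q R (toEntry g x) ω ^ pairExp π g x := by
  rw [interaction, prod_prod_eq_prod_pairIdx g (fun V W => Q (g V) (g W) ω ^ expQ π V W)
    (fun V W => R (g V) (g W) ω ^ expR π V W) fun V => by simp [expR_self]]
  refine prod_congr rfl fun x _ => ?_
  rcases x with p | p <;> rfl

theorem prod_pairIdx_eq {k N : ℕ} (π : PairPartitionB k) (g : π.1.1.parts ↪ Fin N) (μ ν : ℕ → ℝ)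
    (hν0 : ν 0 = 1) :
    ∏ x : PairIdx g, Sum.elim (fun _ => μ) (fun _ => ν) (toEntry g x) (pairExp π g x)
      = ∏ V, ∏ W, ((if g V < g W then μ (expQ π V W) else 1) * ν (expR π V W)) := by
  rw [prod_prod_eq_prod_pairIdx g (fun V W => μ (expQ π V W)) (fun V W => ν (expR π V W))
    fun V => by rw [expR_self, hν0]]
  refine prod_congr rfl fun x _ => ?_
  rcases x with p | p <;> rfl

theorem abs_interaction_le {k N : ℕ} (π : PairPartitionB k) {Q R : ℕ → ℕ → ℝ} {B : ℝ} (hB : 1 ≤ B)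
    (hQ : ∀ i j, i ≠ j → |Q i j| ≤ B) (hR : ∀ i j, i ≠ j → |R i j| ≤ B)
    (g : π.1.1.parts ↪ Fin N) :
    |interaction π Q R g| ≤ ((B ^ 3 * B) ^ Fintype.card π.1.1.parts) ^ Fintype.card π.1.1.parts := by
  have hB0 : 0 ≤ B := by linarith
  rw [interaction, abs_prod]
  rw [← card_univ, ← prod_const]
  refine prod_le_prod (fun _ _ => abs_nonneg _) fun V _ => ?_
  rw [abs_prod, ← prod_const]
  refine prod_le_prod (fun _ _ => abs_nonneg _) fun W _ => ?_
  rw [abs_mul]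
  refine mul_le_mul ?_ ?_ (abs_nonneg _) (by positivity)
  · split_ifs with h
    · have hne : (g V : ℕ) ≠ g W := fun h' => h.ne (Fin.ext h')
      rw [abs_pow]
      exact (pow_le_pow_left₀ (abs_nonneg _) (hQ _ _ hne) _).trans
        (pow_le_pow_right₀ hB (expQ_le π V W))
    · rw [abs_one]; exact one_le_pow₀ hB
  · by_cases hVW : V = W
    · subst hVW
      simpa [expR_self] using hB
    · have hne : (g V : ℕ) ≠ g W := fun h' => hVW (g.injective (Fin.ext h'))
      rw [abs_pow]
      refine (pow_le_pow_left₀ (abs_nonneg _) (hR _ _ hne) _).trans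
        ((pow_le_pow_right₀ hB (expR_le π V W)).trans_eq (pow_one B))

variable {Ω : Type*} [MeasurableSpace Ω] {P : Measure Ω} {Q R : ℕ → ℕ → Ω → ℝ} {Ψ : ℕ → Ω → ℝ}

theorem EntryModel.exists_bound (hmodel : EntryModel P Q R Ψ) :
    ∃ B : ℝ, 1 ≤ B ∧ ∀ᵐ ω ∂P, (∀ i j, i ≠ j → |Q i j ω| ≤ B) ∧ (∀ i j, i ≠ j → |R i j ω| ≤ B)
      ∧ ∀ i, |Ψ i ω| ≤ B := by
  obtain ⟨D1, hD1, -, h1⟩ := hmodel.support_Q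
  obtain ⟨D2, hD2, -, h2⟩ := hmodel.support_R
  obtain ⟨D3, hD3, h3⟩ := hmodel.support_Ψ
  obtain ⟨B1, hB1⟩ := hD1.isBounded.exists_norm_le
  obtain ⟨B2, hB2⟩ := hD2.isBounded.exists_norm_le
  obtain ⟨B3, hB3⟩ := hD3.isBounded.exists_norm_le
  refine ⟨max 1 (max B1 (max B2 B3)), le_max_left _ _, ?_⟩
  have h1' : ∀ᵐ ω ∂P, ∀ i j, i ≠ j → Q i j ω ∈ D1 := by
    simp only [ae_all_iff]; exact h1
  have h2' : ∀ᵐ ω ∂P, ∀ i j, i ≠ j → R i j ω ∈ D2 := by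
    simp only [ae_all_iff]; exact h2
  have h3' : ∀ᵐ ω ∂P, ∀ i, Ψ i ω ∈ D3 := ae_all_iff.2 h3
  filter_upwards [h1', h2', h3'] with ω a b c
  refine ⟨fun i j hij => (hB1 _ (a i j hij)).trans ?_, fun i j hij => (hB2 _ (b i j hij)).trans ?_,
    fun i => (hB3 _ (c i)).trans ?_⟩ <;> simp

theorem EntryModel.measurable_entry (hmodel : EntryModel P Q R Ψ) (x : EntryIdx) :
    Measurable (entry Q R x) := by
  rcases x with p | p
  · exact hmodel.measurable_Q _ _ p.2.ne
  · exact hmodel.measurable_R _ _ p.2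

theorem EntryModel.iIndepFun_entry (hmodel : EntryModel P Q R Ψ) : iIndepFun (entry Q R) P := by
  have h := hmodel.indep.precomp (g := (Sum.map id Sum.inl : EntryIdx → _))
    (Function.Injective.sumMap Function.injective_id Sum.inl_injective)
  convert h using 2 with x
  rcases x with p | p <;> rfl

theorem EntryModel.integral_entry_pow (hmodel : EntryModel P Q R Ψ) (x : EntryIdx) (n : ℕ) :
    ∫ ω, entry Q R x ω ^ n ∂P
      = Sum.elim (fun _ n => ∫ ω, Q 0 1 ω ^ n ∂P) (fun _ n => ∫ ω, R 0 1 ω ^ n ∂P) x n := by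
  rcases x with p | p
  · exact ((hmodel.ident_Q _ _ 0 1 p.2 zero_lt_one).comp (measurable_id.pow_const n)).integral_eq
  · exact ((hmodel.ident_R _ _ 0 1 p.2 zero_ne_one).comp (measurable_id.pow_const n)).integral_eq

theorem EntryModel.integral_prod_entry_pow (hmodel : EntryModel P Q R Ψ) {K : Type*} [Fintype K]
    {j : K → EntryIdx} (hj : Function.Injective j) (n : K → ℕ) :
    ∫ ω, ∏ x, entry Q R (j x) ω ^ n x ∂P
      = ∏ x, Sum.elim (fun _ n => ∫ ω, Q 0 1 ω ^ n ∂P) (fun _ n => ∫ ω, R 0 1 ω ^ n ∂P)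
        (j x) (n x) := by
  rw [(hmodel.iIndepFun_entry.precomp hj).integral_fun_prod_comp (f := fun x y => y ^ n x)
    (fun x => (hmodel.measurable_entry _).aemeasurable)
    (fun x => (measurable_id.pow_const _).aestronglyMeasurable)]
  exact prod_congr rfl fun x _ => hmodel.integral_entry_pow _ _

theorem EntryModel.integral_interaction [IsProbabilityMeasure P] (hmodel : EntryModel P Q R Ψ) {q : ℝ}
    (hQ1 : ∫ ω, Q 0 1 ω ∂P = q) (hQ2 : ∫ ω, Q 0 1 ω ^ 2 ∂P = 1) (hR1 : ∫ ω, R 0 1 ω ∂P = q)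
    {k N : ℕ} (π : PairPartitionB k) (g : π.1.1.parts ↪ Fin N) :
    ∫ ω, interaction π (fun i j => Q i j ω) (fun i j => R i j ω) g ∂P
      = q ^ (Cr π.1 + 2 * Nest π) := by
  simp_rw [interaction_eq_prod_entry]
  rw [hmodel.integral_prod_entry_pow (toEntry_injective g), prod_pairIdx_eq _ _
    (fun n => ∫ ω, Q 0 1 ω ^ n ∂P) (fun n => ∫ ω, R 0 1 ω ^ n ∂P) (by simp)]
  exact prod_means_eq π q (fun n => ∫ ω, Q 0 1 ω ^ n ∂P) (fun n => ∫ ω, R 0 1 ω ^ n ∂P)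
    (by simp) (by simpa using hQ1) hQ2 (by simp) (by simpa using hR1) g

/-- Without a common entry the two families form one independent family, so the mean factors. -/
theorem EntryModel.integral_interaction_mul (hmodel : EntryModel P Q R Ψ)
    {k N : ℕ} (π : PairPartitionB k) {g g' : π.1.1.parts ↪ Fin N}
    (h : Function.Injective (Sum.elim (toEntry g) (toEntry g'))) :
    ∫ ω, interaction π (fun i j => Q i j ω) (fun i j => R i j ω) g
        * interaction π (fun i j => Q i j ω) (fun i j => R i j ω) g' ∂P
      = (∫ ω, interaction π (fun i j => Q i j ω) (fun i j => R i j ω) g ∂P)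
        * ∫ ω, interaction π (fun i j => Q i j ω) (fun i j => R i j ω) g' ∂P := by
  simp_rw [interaction_eq_prod_entry]
  rw [hmodel.integral_prod_entry_pow (toEntry_injective g),
    hmodel.integral_prod_entry_pow (toEntry_injective g')]
  have := hmodel.integral_prod_entry_pow h (Sum.elim (pairExp π g) (pairExp π g'))
  simp only [Fintype.prod_sum_type (α₁ := PairIdx g), Sum.elim_inl, Sum.elim_inr] at this
  exact this

theorem EntryModel.ae_tendsto_interaction [IsProbabilityMeasure P] (hmodel : EntryModel P Q R Ψ) {q : ℝ}
    (hQ1 : ∫ ω, Q 0 1 ω ∂P = q) (hQ2 : ∫ ω, Q 0 1 ω ^ 2 ∂P = 1) (hR1 : ∫ ω, R 0 1 ω ∂P = q)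
    {k : ℕ} (π : PairPartitionB k) :
    ∀ᵐ ω ∂P, Tendsto (fun N : ℕ => ((N : ℝ) ^ Fintype.card π.1.1.parts)⁻¹
        * ∑ g : π.1.1.parts ↪ Fin N, interaction π (fun i j => Q i j ω) (fun i j => R i j ω) g)
      atTop (𝓝 (q ^ (Cr π.1 + 2 * Nest π))) := by
  classical
  obtain ⟨B, hB, hbd⟩ := hmodel.exists_bound
  set n := Fintype.card π.1.1.parts with hn
  set m := q ^ (Cr π.1 + 2 * Nest π) with hm
  set C := ((B ^ 3 * B) ^ n) ^ n with hC
  have hB0 : 0 ≤ B := by linarith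
  let f : ∀ N : ℕ, (π.1.1.parts ↪ Fin N) → Ω → ℝ := fun N g ω =>
    interaction π (fun i j => Q i j ω) (fun i j => R i j ω) g
  let bad : ∀ N : ℕ, Finset ((π.1.1.parts ↪ Fin N) × (π.1.1.parts ↪ Fin N)) := fun N =>
    univ.filter fun x => ¬ Function.Injective (Sum.elim (toEntry x.1) (toEntry x.2))
  have hmeas : ∀ N (g : π.1.1.parts ↪ Fin N), Measurable (f N g) := by
    intro N g
    simp only [f, interaction_eq_prod_entry]
    exact Finset.measurable_fun_prod _ fun x _ => (hmodel.measurable_entry _).pow_const _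
  have hsecond : ∀ N : ℕ, Integrable (fun ω => (∑ g, (f N g ω - m)) ^ 2) P ∧
      ∫ ω, (∑ g, (f N g ω - m)) ^ 2 ∂P ≤ #(bad N) * C ^ 2 := by
    intro N
    refine integral_sum_sub_sq_le (by positivity) (fun g => (hmeas N g).aestronglyMeasurable)
      (hbd.mono fun ω h g => abs_interaction_le π hB h.1 h.2.1 g)
      (fun g => hmodel.integral_interaction hQ1 hQ2 hR1 π g) (bad N) fun x hx => ?_
    simp only [bad, mem_filter, mem_univ, true_and, not_not] at hx
    simp only [f]
    rw [hmodel.integral_interaction_mul π hx, hmodel.integral_interaction hQ1 hQ2 hR1 π,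
      hmodel.integral_interaction hQ1 hQ2 hR1 π]
  -- The shift avoids `N = 0`; the second moment of `Y N` is at most a constant times `1 / (N +
  -- 1)²`.
  let Y : ℕ → Ω → ℝ := fun N ω => (((N + 1 : ℕ) : ℝ) ^ n)⁻¹ * ∑ g, (f (N + 1) g ω - m)
  have hYint : ∀ N, Integrable (fun ω => Y N ω ^ 2) P := fun N => by
    simp only [Y, mul_pow]
    exact (hsecond (N + 1)).1.const_mul _
  have hYsum : Summable fun N => ∫ ω, Y N ω ^ 2 ∂P := by
    have hs : Summable fun N : ℕ => ((2 * n - 2 : ℕ) : ℝ) ^ (2 * n) * C ^ 2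
        * (1 / ((N + 1 : ℕ) : ℝ) ^ 2) :=
      ((summable_nat_add_iff 1).2 (Real.summable_one_div_nat_pow.2 one_lt_two)).mul_left _
    refine Summable.of_nonneg_of_le (fun N => integral_nonneg fun ω => sq_nonneg _) (fun N => ?_) hs
    simp only [Y, mul_pow]
    rw [integral_const_mul]
    have hcard := card_not_injective_mul_le (bad (N + 1)) fun x hx => (mem_filter.1 hx).2
    have hcard' : (#(bad (N + 1)) : ℝ) * ((N + 1 : ℕ) : ℝ) ^ 2
        ≤ ((2 * n - 2 : ℕ) : ℝ) ^ (2 * n) * ((N + 1 : ℕ) : ℝ) ^ (2 * n) := by exact_mod_cast hcard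
    have hpos : (0 : ℝ) < ((N + 1 : ℕ) : ℝ) := by positivity
    calc _ ≤ ((((N + 1 : ℕ) : ℝ) ^ n)⁻¹) ^ 2 * (#(bad (N + 1)) * C ^ 2) := by
          gcongr
          exact (hsecond (N + 1)).2
      _ = (#(bad (N + 1)) * ((N + 1 : ℕ) : ℝ) ^ 2) *
            (C ^ 2 / (((N + 1 : ℕ) : ℝ) ^ (2 * n) * ((N + 1 : ℕ) : ℝ) ^ 2)) := by
          field_simp
          ring
      _ ≤ (((2 * n - 2 : ℕ) : ℝ) ^ (2 * n) * ((N + 1 : ℕ) : ℝ) ^ (2 * n)) *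
            (C ^ 2 / (((N + 1 : ℕ) : ℝ) ^ (2 * n) * ((N + 1 : ℕ) : ℝ) ^ 2)) := by
          gcongr
      _ = _ := by field_simp
  filter_upwards [ae_tendsto_zero_of_summable_integral_sq hYint hYsum] with ω hω
  rw [← tendsto_add_atTop_iff_nat 1]
  have h1 := ((tendsto_add_atTop_iff_nat 1).2 (tendsto_descFactorial_div_pow n)).mul_const m
  have h2 := hω.add h1
  rw [zero_add, one_mul] at h2
  refine h2.congr fun N => ?_
  simp only [Y, f]
  rw [sum_sub_distrib, sum_const, card_univ, Fintype.card_embedding_eq, Fintype.card_fin,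
    nsmul_eq_mul]
  ring

theorem EntryModel.ae_tendsto_Ψ [IsProbabilityMeasure P] (hmodel : EntryModel P Q R Ψ) {c : ℝ}
    (hΨ : ∀ i, ∫ ω, Ψ i ω ∂P = c) :
    ∀ᵐ ω ∂P, Tendsto (fun i => Ψ i ω) atTop (𝓝 c) := by
  obtain ⟨B, hB, hbd⟩ := hmodel.exists_bound
  have h := ae_tendsto_zero_of_summable_integral_sq (P := P) (Y := fun i ω => Ψ i ω - c)
    (fun i => Integrable.of_bound
      (((hmodel.measurable_Ψ i).sub_const c).pow_const 2).aestronglyMeasurable ((B + |c|) ^ 2)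
      (hbd.mono fun ω h => by
        rw [norm_pow, Real.norm_eq_abs]
        exact pow_le_pow_left₀ (abs_nonneg _)
          ((abs_sub _ _).trans (by linarith [h.2.2 i])) 2))
    (hmodel.summable_variance.congr fun i => by
      rw [variance_eq_integral (hmodel.measurable_Ψ i).aemeasurable, hΨ])
  filter_upwards [h] with ω hω
  simpa using hω.add_const c

end Entries

end TypeB

namespace TypeB

open Finset

open MeasureTheory ProbabilityTheory Filter Topology

/-! ### Passage to the limit -/

section Limits

theorem abs_prod_sub_prod_le {ι : Type*} (s : Finset ι) {a b : ι → ℝ} {B : ℝ} (hB : 1 ≤ B)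
    (ha : ∀ i, |a i| ≤ B) (hb : ∀ i, |b i| ≤ B) :
    |∏ i ∈ s, a i - ∏ i ∈ s, b i| ≤ B ^ #s * ∑ i ∈ s, |a i - b i| := by
  classical
  have hB0 : 0 ≤ B := by linarith
  induction s using Finset.induction_on with
  | empty => simp
  | insert i s hi ih =>
    rw [prod_insert hi, prod_insert hi, sum_insert hi, card_insert_of_notMem hi]
    have hprod : |∏ j ∈ s, b j| ≤ B ^ #s := by
      rw [abs_prod, ← prod_const]
      exact prod_le_prod (fun _ _ => abs_nonneg _) fun j _ => hb j
    calc |a i * ∏ j ∈ s, a j - b i * ∏ j ∈ s, b j|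
        = |a i * (∏ j ∈ s, a j - ∏ j ∈ s, b j) + (a i - b i) * ∏ j ∈ s, b j| := by
          congr 1; ring
      _ ≤ |a i| * |∏ j ∈ s, a j - ∏ j ∈ s, b j| + |a i - b i| * |∏ j ∈ s, b j| := by
          rw [← abs_mul, ← abs_mul]; exact abs_add_le _ _
      _ ≤ B * (B ^ #s * ∑ j ∈ s, |a j - b j|) + |a i - b i| * B ^ #s := by
          gcongr
          exact ha i
      _ ≤ B * (B ^ #s * ∑ j ∈ s, |a j - b j|) + |a i - b i| * B ^ (#s + 1) := by
          have := pow_le_pow_right₀ hB (Nat.le_succ #s)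
          gcongr
      _ = _ := by ring

/-- Since `h ≥ 0`, the sum may be enlarged to all maps, under which the value at `V` is uniformly
distributed. -/
theorem sum_embedding_le {ι : Type*} [Fintype ι] [DecidableEq ι] {N : ℕ} [NeZero N] (V : ι)
    {h : ℕ → ℝ} (hh : ∀ i, 0 ≤ h i) :
    ((N : ℝ) ^ Fintype.card ι)⁻¹ * ∑ g : ι ↪ Fin N, h (g V)
      ≤ (N : ℝ)⁻¹ * ∑ i ∈ range N, h i := by
  have hN : (0 : ℝ) < N := by exact_mod_cast Nat.pos_of_ne_zero (NeZero.ne N)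
  have h1 : ∑ g : ι ↪ Fin N, h (g V) ≤ ∑ g : ι → Fin N, h (g V) := by
    rw [← sum_image (f := fun g : ι → Fin N => h (g V)) (g := fun g : ι ↪ Fin N => (g : ι → Fin N))
      (fun _ _ _ _ e => DFunLike.coe_injective e)]
    exact sum_le_sum_of_subset_of_nonneg (subset_univ _) fun _ _ _ => hh _
  have h2 : (N : ℝ) * ∑ g : ι → Fin N, h (g V) = (N : ℝ) ^ Fintype.card ι * ∑ i ∈ range N, h i := by
    -- A product of sums whose only nontrivial factor is at `V`; the other coordinates each give
    -- `N`.
    have h3 := Fintype.prod_sum (fun (i : ι) (j : Fin N) => if i = V then h j else 1)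
    simp only [prod_ite_eq', mem_univ, if_true] at h3
    rw [← h3, ← mul_prod_erase univ _ (mem_univ V),
      prod_congr rfl (g := fun _ => (N : ℝ)) fun i hi => by simp [ne_of_mem_erase hi], prod_const,
      card_erase_of_mem (mem_univ V), card_univ, sum_range]
    have hc : 0 < Fintype.card ι := Fintype.card_pos_iff.2 ⟨V⟩
    obtain ⟨n, hn⟩ : ∃ n, Fintype.card ι = n + 1 := ⟨Fintype.card ι - 1, by omega⟩
    rw [hn, add_tsub_cancel_right, pow_succ]
    simp only [if_true]
    ring
  rw [inv_mul_le_iff₀ (by positivity), ← mul_assoc, mul_comm _ (N : ℝ)⁻¹, mul_assoc, ← h2,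
    inv_mul_cancel_left₀ hN.ne']
  exact h1

variable {Q R : ℕ → ℕ → ℝ} {Ψ : ℕ → ℝ} {B : ℝ}

theorem inv_sqrt_pow_two_mul (N n : ℕ) : (Real.sqrt N)⁻¹ ^ (2 * n) = ((N : ℝ) ^ n)⁻¹ := by
  rw [pow_mul, inv_pow, Real.sq_sqrt (Nat.cast_nonneg N), inv_pow]

theorem tendsto_sum_words_sub (hB : 1 ≤ B) (hQ : ∀ i j, i ≠ j → |Q i j| ≤ B)
    (hR : ∀ i j, i ≠ j → |R i j| ≤ B) (hΨ : ∀ i, |Ψ i| ≤ B) (k : ℕ) :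
    Tendsto (fun N : ℕ => (Real.sqrt N)⁻¹ ^ k *
      (∑ w : Fin k → Fin N × Fin 3, wordWeight Q R Ψ w
        - ∑ π : PairPartitionB k, ∑ g : π.1.1.parts ↪ Fin N, wordWeight Q R Ψ (pairWord π g)))
      atTop (𝓝 0) := by
  set C := ((2 * B ^ 2) ^ k) ^ k with hC
  have hC0 : 0 ≤ C := by positivity
  -- For `k > 0`, the largest `n` with `2n < k`; then `N^(n - k/2) ≤ N^(-1/2)`. The case `k = 0` is
  -- separate, as there `2n + 1 ≤ k` fails.
  set n := (k - 1) / 2 with hn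
  have hlim : Tendsto (fun N : ℕ => ((n : ℝ) ^ k * 3 ^ k * C) * (Real.sqrt N)⁻¹) atTop (𝓝 0) := by
    have := (tendsto_inv_atTop_zero.comp
      (Real.tendsto_sqrt_atTop.comp tendsto_natCast_atTop_atTop)).const_mul ((n : ℝ) ^ k * 3 ^ k * C)
    simpa using this
  refine squeeze_zero_norm' ?_ hlim
  filter_upwards [eventually_ge_atTop 1] with N hN
  have : NeZero N := ⟨by omega⟩
  have hs : 1 ≤ Real.sqrt N := Real.one_le_sqrt.2 (by exact_mod_cast hN)
  have hcard : (#{w : Fin k → Fin N × Fin 3 | 2 * #(univ.image fun p => (w p).1) < k} : ℝ)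
      ≤ (n : ℝ) ^ k * N ^ n * 3 ^ k := by
    have h1 := card_words_le (N := N) (k := k) n
    have h2 : #{w : Fin k → Fin N × Fin 3 | 2 * #(univ.image fun p => (w p).1) < k}
        ≤ n ^ k * N ^ n * 3 ^ k := by
      refine (card_le_card fun w hw => ?_).trans h1
      simp only [mem_filter, mem_univ, true_and] at hw ⊢
      omega
    exact_mod_cast h2
  rcases Nat.eq_zero_or_pos k with hk | hk
  · subst hk
    have h := abs_sum_words_sub_le (N := N) (k := 0) Q R Ψ
    simp only [not_lt_zero, filter_false, sum_empty] at h
    rw [pow_zero, one_mul, Real.norm_eq_abs]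
    exact h.trans (by positivity)
  · have hpow : (Real.sqrt N)⁻¹ ^ k * (N : ℝ) ^ n ≤ (Real.sqrt N)⁻¹ := by
      have hNn : (N : ℝ) ^ n = Real.sqrt N ^ (2 * n) := by
        rw [pow_mul, Real.sq_sqrt (Nat.cast_nonneg N)]
      obtain ⟨r, hr⟩ : ∃ r, k = 2 * n + 1 + r := ⟨k - (2 * n + 1), by omega⟩
      have h0 : Real.sqrt N ≠ 0 := by positivity
      rw [hNn, hr, pow_add, pow_succ, mul_assoc, mul_comm _ (Real.sqrt N ^ (2 * n)), ← mul_assoc,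
        mul_comm _ (Real.sqrt N ^ (2 * n)), ← mul_assoc, ← mul_pow, mul_inv_cancel₀ h0, one_pow,
        one_mul]
      exact mul_le_of_le_one_right (by positivity)
        (pow_le_one₀ (by positivity) (inv_le_one_of_one_le₀ hs))
    rw [norm_mul, Real.norm_eq_abs, Real.norm_eq_abs, abs_of_nonneg (by positivity)]
    calc _ ≤ (Real.sqrt N)⁻¹ ^ k * (((n : ℝ) ^ k * N ^ n * 3 ^ k) * C) := by
          gcongr
          refine (abs_sum_words_sub_le Q R Ψ).trans ?_
          refine (sum_le_card_nsmul _ _ C fun w _ =>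
            abs_wordWeight_le Q R Ψ hB hQ hR hΨ w).trans ?_
          rw [nsmul_eq_mul]
          gcongr
      _ = ((n : ℝ) ^ k * 3 ^ k * C) * ((Real.sqrt N)⁻¹ ^ k * (N : ℝ) ^ n) := by ring
      _ ≤ _ := by gcongr

/-- Replacing each `Ψ` by its limit `c` costs at most a constant times the Cesàro mean of `|Ψ_i -
c|`, as the interactions are uniformly bounded. -/
theorem tendsto_sum_pairWord (hB : 1 ≤ B) (hQ : ∀ i j, i ≠ j → |Q i j| ≤ B)
    (hR : ∀ i j, i ≠ j → |R i j| ≤ B) (hΨ : ∀ i, |Ψ i| ≤ B)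
    (hsymm : ∀ i j, j < i → Q i j = Q j i) {c : ℝ} (hc : Tendsto Ψ atTop (𝓝 c)) {k : ℕ}
    (π : PairPartitionB k) {m : ℝ}
    (hm : Tendsto (fun N : ℕ => ((N : ℝ) ^ Fintype.card π.1.1.parts)⁻¹
        * ∑ g : π.1.1.parts ↪ Fin N, interaction π Q R g) atTop (𝓝 m)) :
    Tendsto (fun N : ℕ => (Real.sqrt N)⁻¹ ^ k *
      ∑ g : π.1.1.parts ↪ Fin N, wordWeight Q R Ψ (pairWord π g)) atTop (𝓝 (c ^ NB π * m)) := by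
  set n := Fintype.card π.1.1.parts with hn
  set C := ((B ^ 3 * B) ^ n) ^ n with hC
  have hB0 : 0 ≤ B := by linarith
  have hcB : |c| ≤ B := le_of_tendsto hc.abs (Eventually.of_forall hΨ)
  have hNB : c ^ NB π = ∏ V, if π.2 V = -1 then c else 1 := by
    rw [NB_eq_card, ← prod_const, prod_filter]
  have hk : ∀ N : ℕ, (Real.sqrt N)⁻¹ ^ k = ((N : ℝ) ^ n)⁻¹ := fun N => by
    rw [← inv_sqrt_pow_two_mul, hn, two_mul_card_parts]
  have hww : ∀ (N : ℕ) (g : π.1.1.parts ↪ Fin N), wordWeight Q R Ψ (pairWord π g)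
      = (∏ V, if π.2 V = -1 then Ψ (g V) else 1) * interaction π Q R g := fun N g => by
    rw [wordWeight_pairWord, prod_siteEntry_eq_interaction π Q R hsymm]
  have hces : Tendsto (fun N : ℕ => (N : ℝ)⁻¹ * ∑ i ∈ range N, |Ψ i - c|) atTop (𝓝 0) := by
    refine Tendsto.cesaro ?_
    have := (hc.sub_const c).abs
    simpa using this
  have hdiff : Tendsto (fun N : ℕ => ((N : ℝ) ^ n)⁻¹ * ∑ g : π.1.1.parts ↪ Fin N,
      ((∏ V, if π.2 V = -1 then Ψ (g V) else 1) - c ^ NB π) * interaction π Q R g)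
      atTop (𝓝 0) := by
    have hlim := hces.const_mul (C * B ^ n * n)
    rw [mul_zero] at hlim
    refine squeeze_zero_norm' ?_ hlim
    filter_upwards [eventually_ge_atTop 1] with N hN
    have : NeZero N := ⟨by omega⟩
    have hterm : ∀ g : π.1.1.parts ↪ Fin N,
        |((∏ V, if π.2 V = -1 then Ψ (g V) else 1) - c ^ NB π) * interaction π Q R g|
          ≤ C * B ^ n * ∑ V, |Ψ (g V) - c| := by
      intro g
      have h1 := abs_prod_sub_prod_le univ (a := fun V => if π.2 V = -1 then Ψ (g V) else 1)
        (b := fun V => if π.2 V = -1 then c else 1) hB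
        (fun V => by split_ifs; exacts [hΨ _, by rwa [abs_one]])
        (fun V => by split_ifs; exacts [hcB, by rwa [abs_one]])
      have h2 : ∑ V, |(if π.2 V = -1 then Ψ (g V) else 1) - (if π.2 V = -1 then c else 1)|
          ≤ ∑ V, |Ψ (g V) - c| := sum_le_sum fun V _ => by
        split_ifs
        · exact le_rfl
        · simp
      rw [abs_mul, hNB]
      calc _ ≤ (B ^ n * ∑ V, |Ψ (g V) - c|) * C := by
            refine mul_le_mul ?_ (abs_interaction_le π hB hQ hR g) (abs_nonneg _) (by positivity)
            rw [card_univ] at h1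
            exact h1.trans (by gcongr)
        _ = _ := by ring
    rw [norm_mul, Real.norm_eq_abs, Real.norm_eq_abs, abs_of_nonneg (by positivity)]
    calc _ ≤ ((N : ℝ) ^ n)⁻¹ * ∑ g : π.1.1.parts ↪ Fin N, (C * B ^ n * ∑ V, |Ψ (g V) - c|) := by
          gcongr
          exact (abs_sum_le_sum_abs _ _).trans (sum_le_sum fun g _ => hterm g)
      _ = C * B ^ n * ∑ V : π.1.1.parts, ((N : ℝ) ^ n)⁻¹ *
            ∑ g : π.1.1.parts ↪ Fin N, |Ψ (g V) - c| := by
          rw [← mul_sum, sum_comm, ← mul_sum]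
          ring
      _ ≤ C * B ^ n * ∑ V : π.1.1.parts, (N : ℝ)⁻¹ * ∑ i ∈ range N, |Ψ i - c| := by
          refine mul_le_mul_of_nonneg_left (sum_le_sum fun V _ => ?_) (by positivity)
          exact sum_embedding_le V (h := fun i => |Ψ i - c|) fun _ => abs_nonneg _
      _ = _ := by
          rw [sum_const, card_univ, nsmul_eq_mul]
          ring
  have h := hdiff.add (hm.const_mul (c ^ NB π))
  rw [zero_add] at h
  refine h.congr fun N => ?_
  simp only [hk, hww, sub_mul, sum_sub_distrib, ← mul_sum]
  ring

theorem tendsto_phi_Z_pow (hB : 1 ≤ B) (hQ : ∀ i j, i ≠ j → |Q i j| ≤ B)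
    (hR : ∀ i j, i ≠ j → |R i j| ≤ B) (hΨ : ∀ i, |Ψ i| ≤ B)
    (hsymm : ∀ i j, j < i → Q i j = Q j i) {c : ℝ} (hc : Tendsto Ψ atTop (𝓝 c)) {k : ℕ}
    {m : PairPartitionB k → ℝ}
    (hm : ∀ π : PairPartitionB k, Tendsto (fun N : ℕ => ((N : ℝ) ^ Fintype.card π.1.1.parts)⁻¹
        * ∑ g : π.1.1.parts ↪ Fin N, interaction π Q R g) atTop (𝓝 (m π))) :
    Tendsto (fun N : ℕ => phi N (Z N Q R Ψ ^ k)) atTop (𝓝 (∑ π, c ^ NB π * m π)) := by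
  have h1 := tendsto_sum_words_sub hB hQ hR hΨ k
  have h2 := tendsto_finsetSum univ fun π (_ : π ∈ univ) =>
    tendsto_sum_pairWord hB hQ hR hΨ hsymm hc π (hm π)
  have h := h1.add h2
  rw [zero_add] at h
  refine h.congr fun N => ?_
  rw [phi_Z_pow, ← mul_sum, mul_sub, sub_add_cancel]

variable {Ω : Type*} [MeasurableSpace Ω] {P : Measure Ω} [IsProbabilityMeasure P]

theorem EntryModel.ae_tendsto_phi_Z_pow {Q R : ℕ → ℕ → Ω → ℝ} {Ψ : ℕ → Ω → ℝ}
    (hmodel : EntryModel P Q R Ψ) {q c : ℝ}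
    (hQ1 : ∫ ω, Q 0 1 ω ∂P = q) (hQ2 : ∫ ω, Q 0 1 ω ^ 2 ∂P = 1) (hR1 : ∫ ω, R 0 1 ω ∂P = q)
    (hΨ : ∀ i, ∫ ω, Ψ i ω ∂P = c) :
    ∀ᵐ ω ∂P, ∀ k : ℕ, Tendsto (fun N : ℕ => phi N
        (Z N (fun i j => Q i j ω) (fun i j => R i j ω) (fun i => Ψ i ω) ^ k)) atTop
      (𝓝 (∑ π : PairPartitionB k, c ^ NB π * q ^ (Cr π.1 + 2 * Nest π))) := by
  obtain ⟨B, hB, hbd⟩ := hmodel.exists_bound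
  have hint : ∀ᵐ ω ∂P, ∀ (k : ℕ) (π : PairPartitionB k),
      Tendsto (fun N : ℕ => ((N : ℝ) ^ Fintype.card π.1.1.parts)⁻¹
        * ∑ g : π.1.1.parts ↪ Fin N, interaction π (fun i j => Q i j ω) (fun i j => R i j ω) g)
      atTop (𝓝 (q ^ (Cr π.1 + 2 * Nest π))) :=
    ae_all_iff.2 fun k => ae_all_iff.2 fun π => hmodel.ae_tendsto_interaction hQ1 hQ2 hR1 π
  filter_upwards [hbd, hint, hmodel.ae_tendsto_Ψ hΨ] with ω h1 h2 h3 k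
  exact tendsto_phi_Z_pow hB h1.1 h1.2.1 h1.2.2
    (fun i j hij => congrFun (hmodel.symm_Q i j hij) ω) h3 (h2 k)

end Limits

end TypeB

open MeasureTheory Filter Topology in
theorem corollary4p2
    {Ω : Type*} [MeasurableSpace Ω] (P : Measure Ω) [IsProbabilityMeasure P]
    {H : Type*} [NormedAddCommGroup H] [InnerProductSpace ℂ H] [CompleteSpace H]
    (J : H →L[ℂ] H) (hJsa : IsSelfAdjoint J) (hJinv : ∀ x, J (J x) = x)
    (e : H) (he : ‖e‖ = 1)
    (α q : ℝ) (hα : α ∈ Set.Ioo (-1 : ℝ) 1) (hq : q ∈ Set.Ioo (-1 : ℝ) 1)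
    (Q R : ℕ → ℕ → Ω → ℝ) (Ψ : ℕ → Ω → ℝ) (hmodel : TypeB.EntryModel P Q R Ψ)
    (hQ1 : ∀ i j, i ≠ j → ∫ ω, Q i j ω ∂P = q)
    (hQ2 : ∀ i j, i ≠ j → ∫ ω, Q i j ω ^ 2 ∂P = 1)
    (hR1 : ∀ i j, i ≠ j → ∫ ω, R i j ω ∂P = q)
    (hΨ : ∀ i, ((∫ ω, Ψ i ω ∂P : ℝ) : ℂ) = (α : ℂ) * inner ℂ e (J e)) :
    (∀ᵐ ω ∂P, ∀ n : ℕ,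
      Tendsto
        (fun N : ℕ => ((TypeB.phi N
          (TypeB.Z N (fun i j => Q i j ω) (fun i j => R i j ω) (fun i => Ψ i ω) ^ (2 * n)) : ℝ) : ℂ))
        atTop
        (𝓝 (∑ π : TypeB.PairPartitionB (2 * n),
          (α : ℂ) ^ TypeB.NB π * (q : ℂ) ^ (TypeB.Cr π.1 + 2 * TypeB.Nest π)
            * inner ℂ e (J e) ^ TypeB.NB π))) ∧
    (∀ n : ℕ,
      ∑ π : TypeB.PairPartitionB (2 * n),
          (α : ℂ) ^ TypeB.NB π * (q : ℂ) ^ (TypeB.Cr π.1 + 2 * TypeB.Nest π)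
            * inner ℂ e (J e) ^ TypeB.NB π
        = TypeB.vacuumMoment α q J e (2 * n)) ∧
    (∀ᵐ ω ∂P, ∀ k : ℕ,
      Tendsto
        (fun N : ℕ => ((TypeB.phi N
          (TypeB.Z N (fun i j => Q i j ω) (fun i j => R i j ω) (fun i => Ψ i ω) ^ k) : ℝ) : ℂ))
        atTop
        (𝓝 (TypeB.vacuumMoment α q J e k))) := by
  set s : ℂ := inner ℂ e (J e) with hs
  set c : ℝ := ∫ ω, Ψ 0 ω ∂P with hc
  -- The mean hypothesis makes `α * s` real, so the limit can be computed in `ℝ` and then cast.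
  have hcs : (c : ℂ) = α * s := hΨ 0
  have hΨc : ∀ i, ∫ ω, Ψ i ω ∂P = c := fun i =>
    Complex.ofReal_injective ((hΨ i).trans hcs.symm)
  have hsum : ∀ k : ℕ, ((∑ π : TypeB.PairPartitionB k,
      c ^ TypeB.NB π * q ^ (TypeB.Cr π.1 + 2 * TypeB.Nest π) : ℝ) : ℂ)
      = ∑ π : TypeB.PairPartitionB k, (α : ℂ) ^ TypeB.NB π
        * (q : ℂ) ^ (TypeB.Cr π.1 + 2 * TypeB.Nest π) * s ^ TypeB.NB π := fun k => by
    push_cast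
    refine Finset.sum_congr rfl fun π _ => ?_
    rw [hcs, mul_pow]
    ring
  have hmoment := TypeB.sum_pairPartitionB_eq_vacuumMoment α q J e he
  have hlim : ∀ᵐ ω ∂P, ∀ k : ℕ, Tendsto
      (fun N : ℕ => ((TypeB.phi N
        (TypeB.Z N (fun i j => Q i j ω) (fun i j => R i j ω) (fun i => Ψ i ω) ^ k) : ℝ) : ℂ)) atTop
      (𝓝 (TypeB.vacuumMoment α q J e k)) := by
    filter_upwards [hmodel.ae_tendsto_phi_Z_pow (hQ1 0 1 zero_ne_one) (hQ2 0 1 zero_ne_one)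
      (hR1 0 1 zero_ne_one) hΨc] with ω hω k
    rw [← hmoment, ← hs, ← hsum]
    exact (Complex.continuous_ofReal.tendsto _).comp (hω k)
  refine ⟨hlim.mono fun ω hω n => ?_, fun n => hmoment (2 * n), hlim⟩
  rw [hs, hmoment]
  exact hω (2 * n)
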